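/- Let $L$ be a stably continuous lattice, i.e. a complete lattice, with way-below relation $\ll$ ($x\ll y$ iff every directed $D\subseteq L$ with $y\le\sup D$ has an element above $x$), such that every $x$ is the directed supremum of $\{y\mid y\ll x\}$, $\top\ll\top$, and $x\ll y$, $x\ll z$ imply $x\ll y\wedge z$. Let $\sigma\mathrm{Filt}(L)$ be the poset, ordered by inclusion, of Scott-open filters of $L$, i.e. filters $k$ such that every directed $D\subseteq L$ with $\sup D\in k$ meets $k$. Let $\mathcal C$ be a category with all small limits and colimits that is Barr-exact (regular, with every internal equivalence relation the kernel pair of a regular epimorphism) and in which directed colimits commute with finite limits, and let $A$ be an object of $\mathcal C$. Let $\mathrm{Equiv}(A)$ be the (possibly large) poset of equivalence relations on $A$, ordered as subobjects of $A\times A$; the composite of two relations on $A$ is the image in $A\times A$ of their pullback over the middle factor $A$, and $R,S\in\mathrm{Equiv}(A)$ commute if $R\circ S=S\circ R$. An $\Omega$-sheaf on $L$ is a functor $F\colon L^{\mathrm{op}}\to\mathcal C$ such that (1) $F(\bot)$ is subterminal; (2) for all $x,y\in L$ the square formed by the restrictions $F(x\vee y)\to F(x)\to F(x\wedge y)$ and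 $F(x\vee y)\to F(y)\to F(x\wedge y)$ is a pullback; (3) for every directed $D\subseteq L$ the cone $(F(\sup D)\to F(d))_{d\in D}$ is a limit of the restriction of $F$ to $D$. It is soft if for every $k\in\sigma\mathrm{Filt}(L)$ the canonical arrow $F(\top)\to\operatorname{colim}_{x\in k}F(x)$ is a regular epimorphism. A soft $\Omega$-sheaf representation of $A$ over $L$ is a pair $(F,\phi)$ with $F$ a soft $\Omega$-sheaf on $L$ and $\phi\colon A\to F(\top)$ an isomorphism; a morphism $(F,\phi)\to(G,\psi)$ is a natural transformation $\alpha\colon F\Rightarrow G$ with $\alpha_\top\circ\phi=\psi$. Then between any two soft $\Omega$-sheaf representations of $A$ over $L$ there is at most one morphism, i.e. they form a (large) preorder; and its poset reflection, whose elements are the isomorphism classes of soft $\Omega$-sheaf representations of $A$ over $L$ with $[(F,\phi)]\le[(G,\psi)]$ iff there is a morphism $(F,\phi)\to(G,\psi)$, is order-isomorphic to the poset, ordered pointwise, of the monotone maps $H\colon\sigma\mathrm{Filt}(L)\to\mathrm{Equiv}(A)$ that preserve finite infima and arbitrary suprema (including the empty ones) and such that $H(k)$ and $H(l)$ commute for all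 $k,l\in\sigma\mathrm{Filt}(L)$. -/

import Mathlib

open CategoryTheory CategoryTheory.Limits Opposite

universe v u

noncomputable section

namespace SoftSheaf

/-! ### Stably continuous lattices and Scott-open filters -/

section Lattices

variable {L : Type v} [CompleteLattice L]

/-- The way-below relation `x ≪ y` of a complete lattice: every directed set whose supremum is
above `y` has an element above `x`. (Directed sets are non-empty.) -/
def WayBelow (x y : L) : Prop :=
  ∀ D : Set L, D.Nonempty → DirectedOn (· ≤ ·) D → y ≤ sSup D → ∃ d ∈ D, x ≤ d

variable (L) in
/-- A complete lattice is continuous if every `x` is the directed supremum of the elements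
way below it. -/
class IsContinuousLattice : Prop where
  nonempty_wayBelow : ∀ x : L, {y : L | WayBelow y x}.Nonempty
  directedOn_wayBelow : ∀ x : L, DirectedOn (· ≤ ·) {y : L | WayBelow y x}
  isLUB_wayBelow : ∀ x : L, IsLUB {y : L | WayBelow y x} x

variable (L) in
/-- A stably continuous lattice is a continuous lattice whose way-below relation is
multiplicative. -/
class IsStablyContinuousLattice : Prop extends IsContinuousLattice L where
  top_wayBelow_top : WayBelow (⊤ : L) ⊤
  wayBelow_inf : ∀ x y z : L, WayBelow x y → WayBelow x z → WayBelow x (y ⊓ z)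

variable (L) in
/-- The poset of Scott-open filters of `L`, ordered by inclusion. -/
abbrev ScottOpenFilter : Type v :=
  {k : Order.PFilter L // DirSupInacc (k : Set L)}

/-- The set of elements of a Scott-open filter. -/
def ScottOpenFilter.carrier (k : ScottOpenFilter L) : Set L := (k.1 : Set L)

theorem ScottOpenFilter.top_mem (k : ScottOpenFilter L) : (⊤ : L) ∈ k.carrier :=
  Order.PFilter.top_mem

end Lattices

/-! ### Barr-exact categories and equivalence relations -/

section Relations

/-- A regular category is Barr-exact if every (internal) equivalence relation is effective, i.e.
is the kernel pair of a regular epimorphism. -/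
class BarrExact (C : Type u) [Category.{v} C] : Prop extends CategoryTheory.Regular C where
  isEffective : ∀ {R A : C} (p₁ p₂ : R ⟶ A), IsEquivalenceRelation p₁ p₂ →
    IsEffectiveEquivalenceRelation p₁ p₂

variable {C : Type u} [Category.{v} C] [CategoryTheory.Regular C]

/-- The poset `Equiv(A)` of equivalence relations on `A`, as a sub-poset of `Sub(A × A)`. -/
abbrev EquivRel (A : C) : Type (max u v) :=
  {R : Subobject (A ⨯ A) // IsEquivalenceRelation (R.arrow ≫ prod.fst) (R.arrow ≫ prod.snd)}

/-- The composite `R ∘ S` of two relations on `A`: the image in `A × A` of the object of pairs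
`(r, s)` in `R × S` such that the second component of `r` is the first component of `s`. -/
def relComp {A : C} (R S : Subobject (A ⨯ A)) : Subobject (A ⨯ A) :=
  imageSubobject
    (prod.lift
      (pullback.fst (R.arrow ≫ prod.snd) (S.arrow ≫ prod.fst) ≫ R.arrow ≫ prod.fst)
      (pullback.snd (R.arrow ≫ prod.snd) (S.arrow ≫ prod.fst) ≫ S.arrow ≫ prod.snd))

/-- Two equivalence relations commute if their two composites are the same relation. -/
def EquivRel.Commute {A : C} (R S : EquivRel A) : Prop :=
  relComp R.1 S.1 = relComp S.1 R.1

/-- A map between posets preserves finite infima (including the empty one). -/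
def PreservesFiniteInfima {P Q : Type*} [Preorder P] [Preorder Q] (H : P → Q) : Prop :=
  ∀ (S : Set P) (a : P), S.Finite → IsGLB S a → IsGLB (H '' S) (H a)

/-- A map between posets preserves arbitrary suprema (including the empty one). -/
def PreservesSuprema {P Q : Type*} [Preorder P] [Preorder Q] (H : P → Q) : Prop :=
  ∀ (S : Set P) (a : P), IsLUB S a → IsLUB (H '' S) (H a)

/-- The poset, ordered pointwise, of the monotone maps from Scott-open filters of `L` to
equivalence relations on `A` that preserve finite infima and arbitrary suprema, and whose image
consists of pairwise commuting equivalence relations. -/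
abbrev CommutingMap (L : Type v) [CompleteLattice L] (A : C) : Type (max u v) :=
  {H : ScottOpenFilter L →o EquivRel A //
    PreservesFiniteInfima H ∧ PreservesSuprema H ∧ ∀ k l, (H k).Commute (H l)}

end Relations

/-! ### Soft Ω-sheaf representations -/

section Sheaves

variable {C : Type u} [Category.{v} C] {L : Type v} [CompleteLattice L]

/-- The restriction of a presheaf on `L` to a subset of `L` with the induced order. -/
abbrev restrict (F : Lᵒᵖ ⥤ C) (S : Set L) : (↥S)ᵒᵖ ⥤ C :=
  (Subtype.mono_coe (· ∈ S)).functor.op ⋙ F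

/-- The cone `(F(sup D) → F(d))` for `d ∈ D`, over the restriction of `F` to `D`. -/
def supCone (F : Lᵒᵖ ⥤ C) (D : Set L) : Cone (restrict F D) where
  pt := F.obj (op (sSup D))
  π :=
    { app := fun d => F.map (homOfLE (le_sSup d.unop.2)).op
      naturality := fun d e f => by
        dsimp
        rw [Category.id_comp, ← F.map_comp]
        rfl }

/-- `C`-valued Ω-sheaves on a complete lattice. -/
structure IsOmegaSheaf (F : Lᵒᵖ ⥤ C) : Prop where
  subterminal : IsSubterminal (F.obj (op ⊥))
  isPullback : ∀ x y : L, IsPullback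
    (F.map (homOfLE (le_sup_left : x ≤ x ⊔ y)).op)
    (F.map (homOfLE (le_sup_right : y ≤ x ⊔ y)).op)
    (F.map (homOfLE (inf_le_left : x ⊓ y ≤ x)).op)
    (F.map (homOfLE (inf_le_right : x ⊓ y ≤ y)).op)
  isLimit : ∀ D : Set L, D.Nonempty → DirectedOn (· ≤ ·) D → Nonempty (IsLimit (supCone F D))

/-- Softness: for every Scott-open filter `k`, the canonical arrow from `F(⊤)` to the colimit of
the `F(x)` with `x ∈ k` is a regular epimorphism. -/
def IsSoft [HasColimits C] (F : Lᵒᵖ ⥤ C) : Prop :=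
  ∀ k : ScottOpenFilter L,
    IsRegularEpi (colimit.ι (restrict F k.carrier) (op ⟨⊤, k.top_mem⟩))

/-- An Ω-sheaf representation of `A` over `L`: an Ω-sheaf `F` with an isomorphism `A ≅ F(⊤)`. -/
structure OmegaSheafRep (L : Type v) [CompleteLattice L] (A : C) where
  /-- the underlying presheaf -/
  sheaf : Lᵒᵖ ⥤ C
  isOmegaSheaf : IsOmegaSheaf sheaf
  /-- the identification of `A` with the global sections -/
  iso : A ≅ sheaf.obj (op ⊤)

/-- Morphisms of representations are the natural transformations compatible with the
identifications of `A` with the global sections. -/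
@[ext]
structure OmegaSheafRep.Hom {A : C} (F G : OmegaSheafRep L A) where
  /-- the underlying natural transformation -/
  nat : F.sheaf ⟶ G.sheaf
  iso_comp : F.iso.hom ≫ nat.app (op ⊤) = G.iso.hom

instance (A : C) : Category (OmegaSheafRep L A) where
  Hom := OmegaSheafRep.Hom
  id F :=
    { nat := 𝟙 _
      iso_comp := by simp }
  comp f g :=
    { nat := f.nat ≫ g.nat
      iso_comp := by rw [NatTrans.comp_app, ← Category.assoc, f.iso_comp, g.iso_comp] }
  id_comp f := OmegaSheafRep.Hom.ext (Category.id_comp f.nat)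
  comp_id f := OmegaSheafRep.Hom.ext (Category.comp_id f.nat)
  assoc f g h := OmegaSheafRep.Hom.ext (Category.assoc f.nat g.nat h.nat)

/-- The full subcategory of the soft Ω-sheaf representations of `A` over `L`. -/
abbrev SoftOmegaSheafRep [HasColimits C] (L : Type v) [CompleteLattice L] (A : C) :=
  ObjectProperty.FullSubcategory (fun F : OmegaSheafRep L A => IsSoft F.sheaf)

/-- Colimits indexed by (small, non-empty) directed posets commute with finite limits in `C`. -/
def DirectedColimitsCommuteWithFiniteLimits (C : Type u) [Category.{v} C] [HasColimits C] : Prop :=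
  ∀ (J : Type v) [PartialOrder J] [Nonempty J], IsDirected J (· ≤ ·) →
    PreservesFiniteLimits (colim : (J ⥤ C) ⥤ C)

end Sheaves

end SoftSheaf

end

/-! A soft representation $F$ is sent to the map $k \mapsto$ kernel pair of $A \cong F(\top) \to
F_k$, where $F_k = \operatorname{colim}_{x \in k} F(x)$ is the stalk at $k$ (`stalkKer`). By
interpolation, whenever $y \ll x$ there is a Scott-open filter that contains $x$ and is bounded
below by $y$. Hence $F(x)$ is the limit of the stalks at the filters containing $x$
(`IsOmegaSheaf.hom_ext`, `IsOmegaSheaf.exists_lift`). Softness makes each $A \to F_k$ a quotient, so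
maps of stalks under $A$ are unique, and exist when the kernel pairs are included in each other.
This yields both thinness and the description of the order (`hom_subsingleton`, `exists_hom`).

Since directed colimits commute with pullbacks, the binary sheaf condition passes to the stalks at
$k \cap l$, $k$, $l$ and $k \vee l$ (`IsOmegaSheaf.isPullback_stalk`). Uniqueness of gluing gives
binary infima. Existence of gluing, together with softness, shows that the relation at $k \vee l$ is
the composite of those at $k$ and $l$, which gives commutation and binary suprema.

Conversely, $H$ gives the presheaf $x \mapsto \lim_{k \ni x} A/H(k)$ (`quotSheaf`). The Chinese
remainder theorem for commuting equivalence relations (`EquivRel.exists_quot_lift`) provides the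
binary sheaf condition, and preservation of suprema identifies the kernel pair at $k$ with $H(k)$
(`CommutingMap.stalkKer_rep`). As the first assignment preserves and reflects the order, this
suffices. -/

noncomputable section
namespace SoftSheaf

/-! ### Criteria for preserving finite infima and arbitrary suprema. -/

section OrderLemmas

variable {P Q : Type*} [Preorder P] [Preorder Q] {H : P → Q}

/-- A monotone map preserves finite infima as soon as it preserves a top element and binary
lower bounds in the following sense. -/
theorem preservesFiniteInfima_of_binary (hH : Monotone H) (htop : ∃ t : P, ∀ E, E ≤ H t)
    (hinf : ∀ k l : P, ∃ m, m ≤ k ∧ m ≤ l ∧ ∀ E, E ≤ H k → E ≤ H l → E ≤ H m) :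
    PreservesFiniteInfima H := by
  -- It is enough to find some lower bound `c` of `S` whose image is above every lower bound of the
  -- image: an infimum of `S` lies above `c`.
  have key : ∀ S : Set P, S.Finite →
      ∃ c ∈ lowerBounds S, ∀ E ∈ lowerBounds (H '' S), E ≤ H c := by
    intro S hS
    induction S, hS using Set.Finite.induction_on with
    | empty =>
      obtain ⟨t, ht⟩ := htop
      exact ⟨t, by simp, fun E _ => ht E⟩
    | @insert a S _ _ ih =>
      obtain ⟨c, hc, hE⟩ := ih
      obtain ⟨m, hma, hmc, hm⟩ := hinf a c
      refine ⟨m, ?_, fun E hEl => hm E (hEl ⟨a, by simp, rfl⟩) (hE E ?_)⟩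
      · rintro x (rfl | hx)
        · exact hma
        · exact hmc.trans (hc hx)
      · rintro _ ⟨x, hx, rfl⟩
        exact hEl ⟨x, Or.inr hx, rfl⟩
  intro S a hS ha
  refine ⟨?_, fun E hE => ?_⟩
  · rintro _ ⟨x, hx, rfl⟩
    exact hH (ha.1 hx)
  · obtain ⟨c, hc, hcE⟩ := key S hS
    exact (hcE E hE).trans (hH (ha.2 hc))

/-- A monotone map preserves arbitrary suprema as soon as it preserves a bottom element, binary
upper bounds and directed suprema in the following sense. -/
theorem preservesSuprema_of_directed (hH : Monotone H) (hbot : ∃ b : P, ∀ E, H b ≤ E)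
    (hsup : ∀ k l : P, ∃ m, k ≤ m ∧ l ≤ m ∧ ∀ E, H k ≤ E → H l ≤ E → H m ≤ E)
    (hdir : ∀ D : Set P, D.Nonempty → DirectedOn (· ≤ ·) D →
      ∃ m ∈ upperBounds D, ∀ E ∈ upperBounds (H '' D), H m ≤ E) :
    PreservesSuprema H := by
  intro S a ha
  refine ⟨?_, fun E hE => ?_⟩
  · rintro _ ⟨x, hx, rfl⟩
    exact hH (ha.1 hx)
  · obtain ⟨m, hm, hmE⟩ := hdir {k | H k ≤ E}
      (by obtain ⟨b, hb⟩ := hbot; exact ⟨b, hb E⟩)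
      (by
        intro k hk l hl
        obtain ⟨m, hkm, hlm, hm⟩ := hsup k l
        exact ⟨m, hm E hk hl, hkm, hlm⟩)
    refine (hH (ha.2 fun x hx => hm ?_)).trans (hmE E ?_)
    · exact hE ⟨x, hx, rfl⟩
    · rintro _ ⟨x, hx, rfl⟩
      exact hx

end OrderLemmas

/-! ### Scott-open filters and interpolation. -/

section Filters

variable {L : Type v} [CompleteLattice L]

theorem WayBelow.le {x y : L} (h : WayBelow x y) : x ≤ y := by
  obtain ⟨d, hd, hxd⟩ := h {y} ⟨y, rfl⟩ (by rintro _ rfl _ rfl; exact ⟨_, rfl, le_rfl, le_rfl⟩)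
    (by simp)
  rw [Set.mem_singleton_iff] at hd
  exact hd ▸ hxd

theorem WayBelow.mono {x x' y y' : L} (hx : x' ≤ x) (h : WayBelow x y) (hy : y ≤ y') :
    WayBelow x' y' := fun D hD hdir hsup =>
  let ⟨d, hd, hxd⟩ := h D hD hdir (hy.trans hsup)
  ⟨d, hd, hx.trans hxd⟩

namespace ScottOpenFilter

theorem le_def {k l : ScottOpenFilter L} : k ≤ l ↔ ∀ x ∈ k.carrier, x ∈ l.carrier := Iff.rfl

theorem mem_mono {k l : ScottOpenFilter L} (h : k ≤ l) {x : L} (hx : x ∈ k.carrier) :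
    x ∈ l.carrier := h hx

theorem mem_of_le {k : ScottOpenFilter L} {x y : L} (h : x ≤ y) (hx : x ∈ k.carrier) :
    y ∈ k.carrier := k.1.mem_of_le h hx

theorem inf_mem {k : ScottOpenFilter L} {x y : L} (hx : x ∈ k.carrier) (hy : y ∈ k.carrier) :
    x ⊓ y ∈ k.carrier := k.1.inf_mem hx hy

theorem exists_mem_of_sSup_mem {k : ScottOpenFilter L} {D : Set L} (hD : D.Nonempty)
    (hdir : DirectedOn (· ≤ ·) D) (h : sSup D ∈ k.carrier) : ∃ d ∈ D, d ∈ k.carrier :=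
  k.2 hD hdir (isLUB_sSup D) h

/-- Construct a Scott-open filter from its set of elements. -/
def ofSet (s : Set L) (htop : ⊤ ∈ s) (hle : ∀ x y, x ≤ y → x ∈ s → y ∈ s)
    (hinf : ∀ x ∈ s, ∀ y ∈ s, x ⊓ y ∈ s)
    (hopen : ∀ D : Set L, D.Nonempty → DirectedOn (· ≤ ·) D → sSup D ∈ s → ∃ d ∈ D, d ∈ s) :
    ScottOpenFilter L :=
  ⟨(show Order.IsPFilter s from Order.IsPFilter.of_def ⟨⊤, htop⟩
      (fun x hx y hy => ⟨x ⊓ y, hinf x hx y hy, inf_le_left, inf_le_right⟩)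
      (fun {x y} hxy hx => hle x y hxy hx)).toPFilter, by
    intro D hD hdir a ha has
    obtain rfl := ha.sSup_eq
    exact hopen D hD hdir has⟩

/-- The intersection of two Scott-open filters. -/
def inter (k l : ScottOpenFilter L) : ScottOpenFilter L :=
  ofSet (k.carrier ∩ l.carrier) ⟨k.top_mem, l.top_mem⟩
    (fun _ _ h hx => ⟨mem_of_le h hx.1, mem_of_le h hx.2⟩)
    (fun _ hx _ hy => ⟨inf_mem hx.1 hy.1, inf_mem hx.2 hy.2⟩)
    (fun D hD hdir h => by
      obtain ⟨d, hd, hdk⟩ := exists_mem_of_sSup_mem hD hdir h.1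
      obtain ⟨e, he, hel⟩ := exists_mem_of_sSup_mem hD hdir h.2
      obtain ⟨f, hf, hdf, hef⟩ := hdir d hd e he
      exact ⟨f, hf, mem_of_le hdf hdk, mem_of_le hef hel⟩)

theorem inter_le_left (k l : ScottOpenFilter L) : inter k l ≤ k := fun _ h => h.1

theorem inter_le_right (k l : ScottOpenFilter L) : inter k l ≤ l := fun _ h => h.2

theorem le_inter {k l m : ScottOpenFilter L} (hk : m ≤ k) (hl : m ≤ l) : m ≤ inter k l :=
  fun _ h => ⟨hk h, hl h⟩

theorem isGLB_inter (k l : ScottOpenFilter L) : IsGLB {k, l} (inter k l) := by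
  refine ⟨?_, fun m hm => le_inter (hm (by simp)) (hm (by simp))⟩
  rintro _ (rfl | rfl)
  · exact inter_le_left _ _
  · exact inter_le_right _ _

variable (L) in
/-- The Scott-open filter of all elements. -/
def all : ScottOpenFilter L :=
  ofSet Set.univ trivial (fun _ _ _ _ => trivial) (fun _ _ _ _ => trivial)
    (fun _ hD _ _ => hD.imp fun _ hd => ⟨hd, trivial⟩)

theorem mem_all (x : L) : x ∈ (all L).carrier := trivial

theorem le_all (k : ScottOpenFilter L) : k ≤ all L := fun _ _ => trivial

theorem eq_all_of_bot_mem {k : ScottOpenFilter L} (h : ⊥ ∈ k.carrier) : k = all L :=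
  le_antisymm (le_all k) fun _ _ => mem_of_le bot_le h

/-- The union of a directed set of Scott-open filters. -/
def sUnion (D : Set (ScottOpenFilter L)) (hD : D.Nonempty) (hdir : DirectedOn (· ≤ ·) D) :
    ScottOpenFilter L :=
  ofSet {x | ∃ k ∈ D, x ∈ k.carrier} (hD.imp fun k hk => ⟨hk, k.top_mem⟩)
    (fun _ _ h ⟨k, hk, hx⟩ => ⟨k, hk, mem_of_le h hx⟩)
    (fun _ ⟨k, hk, hx⟩ _ ⟨l, hl, hy⟩ => by
      obtain ⟨m, hm, hkm, hlm⟩ := hdir k hk l hl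
      exact ⟨m, hm, inf_mem (hkm hx) (hlm hy)⟩)
    (fun E hE hEdir ⟨k, hk, h⟩ => by
      obtain ⟨d, hd, hdk⟩ := exists_mem_of_sSup_mem hE hEdir h
      exact ⟨d, hd, k, hk, hdk⟩)

theorem mem_sUnion {D : Set (ScottOpenFilter L)} {hD : D.Nonempty}
    {hdir : DirectedOn (· ≤ ·) D} {x : L} :
    x ∈ (sUnion D hD hdir).carrier ↔ ∃ k ∈ D, x ∈ k.carrier := Iff.rfl

theorem le_sUnion {D : Set (ScottOpenFilter L)} {hD : D.Nonempty}
    {hdir : DirectedOn (· ≤ ·) D} {k : ScottOpenFilter L} (hk : k ∈ D) :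
    k ≤ sUnion D hD hdir := fun _ hx => ⟨k, hk, hx⟩

end ScottOpenFilter

section Continuous

variable [IsContinuousLattice L]

/-- Interpolation: the elements lying two way-below steps under `x` form a directed set whose
supremum is still above `x`, so one of them is above `y`. -/
theorem exists_wayBelow_sandwich {x y : L} (h : WayBelow y x) :
    ∃ z, WayBelow y z ∧ WayBelow z x := by
  obtain ⟨w, ⟨z, hwz, hzx⟩, hyw⟩ := h {w | ∃ z, WayBelow w z ∧ WayBelow z x}
    (by
      obtain ⟨z, hz⟩ := IsContinuousLattice.nonempty_wayBelow x
      obtain ⟨w, hw⟩ := IsContinuousLattice.nonempty_wayBelow z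
      exact ⟨w, z, hw, hz⟩)
    (by
      rintro w₁ ⟨z₁, hw₁, hz₁⟩ w₂ ⟨z₂, hw₂, hz₂⟩
      obtain ⟨z, hz, h₁, h₂⟩ := IsContinuousLattice.directedOn_wayBelow x z₁ hz₁ z₂ hz₂
      obtain ⟨w, hw, h₁', h₂'⟩ := IsContinuousLattice.directedOn_wayBelow z
        w₁ (hw₁.mono le_rfl h₁) w₂ (hw₂.mono le_rfl h₂)
      exact ⟨w, ⟨z, hw, hz⟩, h₁', h₂'⟩)
    (by
      refine (IsContinuousLattice.isLUB_wayBelow x).2 fun z hz => ?_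
      exact (IsContinuousLattice.isLUB_wayBelow z).2 fun w hw => le_sSup ⟨z, hw, hz⟩)
  exact ⟨z, hwz.mono hyw le_rfl, hzx⟩

theorem sSup_wayBelow (x : L) : sSup {y | WayBelow y x} = x :=
  (IsContinuousLattice.isLUB_wayBelow x).sSup_eq

namespace ScottOpenFilter

theorem exists_wayBelow_mem {k : ScottOpenFilter L} {x : L} (hx : x ∈ k.carrier) :
    ∃ y ∈ k.carrier, WayBelow y x := by
  obtain ⟨y, hy, hyk⟩ := exists_mem_of_sSup_mem (k := k)
    (IsContinuousLattice.nonempty_wayBelow x) (IsContinuousLattice.directedOn_wayBelow x)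
    (by rwa [sSup_wayBelow])
  exact ⟨y, hyk, hy⟩

/-- Every element way below `x` is a lower bound of a Scott-open filter containing `x`. -/
theorem exists_of_wayBelow {x y : L} (h : WayBelow y x) :
    ∃ k : ScottOpenFilter L, x ∈ k.carrier ∧ ∀ z ∈ k.carrier, y ≤ z := by
  -- Iterated interpolation gives a sequence descending from `x`, each term way below the previous
  -- one and way above `y`. Its upward closure is the filter, and it is Scott-open because `s (n +
  -- 1)` is way below `s n`.
  choose f hf₁ hf₂ using fun z : {z : L // WayBelow y z} => exists_wayBelow_sandwich z.2
  let s : ℕ → {z : L // WayBelow y z} := fun n => n.rec ⟨x, h⟩ fun _ z => ⟨f z, hf₁ z⟩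
  have hs : ∀ n, WayBelow (s (n + 1)).1 (s n).1 := fun n => hf₂ (s n)
  have hanti : Antitone fun n => (s n).1 := antitone_nat_of_succ_le fun n => (hs n).le
  refine ⟨ofSet {z | ∃ n, (s n).1 ≤ z} ⟨0, le_top⟩ (fun _ _ h ⟨n, hn⟩ => ⟨n, hn.trans h⟩) ?_ ?_,
    ⟨0, le_rfl⟩, fun z ⟨n, hn⟩ => (s n).2.le.trans hn⟩
  · rintro a ⟨m, hm⟩ b ⟨n, hn⟩
    exact ⟨max m n, le_inf ((hanti (le_max_left m n)).trans hm)
      ((hanti (le_max_right m n)).trans hn)⟩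
  · rintro D hD hdir ⟨n, hn⟩
    obtain ⟨d, hd, hle⟩ := hs n D hD hdir hn
    exact ⟨d, hd, n + 1, hle⟩

/-- The principal filter of `y` is sandwiched between `l` and `k`, so maps of stalks from `l` to `k`
factor through the sections over `y`. -/
theorem exists_between {k : ScottOpenFilter L} {x : L} (hx : x ∈ k.carrier) :
    ∃ y ∈ k.carrier, WayBelow y x ∧
      ∃ l : ScottOpenFilter L, x ∈ l.carrier ∧ (∀ z ∈ l.carrier, y ≤ z) ∧ l ≤ k := by
  obtain ⟨y, hy, hyx⟩ := exists_wayBelow_mem hx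
  obtain ⟨l, hxl, hl⟩ := exists_of_wayBelow hyx
  exact ⟨y, hy, hyx, l, hxl, hl, fun z hz => mem_of_le (hl z hz) hy⟩

/-- A Scott-open filter containing `x ⊔ y` contains the intersection of a Scott-open filter
containing `x` with one containing `y`. -/
theorem exists_inter_le_of_sup_mem {m : ScottOpenFilter L} {x y : L}
    (h : x ⊔ y ∈ m.carrier) :
    ∃ k l : ScottOpenFilter L, x ∈ k.carrier ∧ y ∈ l.carrier ∧ inter k l ≤ m := by
  -- The joins of an element way below `x` with one way below `y` are directed with supremum above
  -- `x ⊔ y`, so openness puts one of them in `m`.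
  obtain ⟨d, ⟨x', hx', y', hy', rfl⟩, hd⟩ := exists_mem_of_sSup_mem (k := m)
    (D := {d | ∃ x', WayBelow x' x ∧ ∃ y', WayBelow y' y ∧ x' ⊔ y' = d})
    (by
      obtain ⟨x', hx'⟩ := IsContinuousLattice.nonempty_wayBelow x
      obtain ⟨y', hy'⟩ := IsContinuousLattice.nonempty_wayBelow y
      exact ⟨_, x', hx', y', hy', rfl⟩)
    (by
      rintro _ ⟨x₁, hx₁, y₁, hy₁, rfl⟩ _ ⟨x₂, hx₂, y₂, hy₂, rfl⟩
      obtain ⟨x', hx', h₁, h₂⟩ := IsContinuousLattice.directedOn_wayBelow x x₁ hx₁ x₂ hx₂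
      obtain ⟨y', hy', h₃, h₄⟩ := IsContinuousLattice.directedOn_wayBelow y y₁ hy₁ y₂ hy₂
      exact ⟨_, ⟨x', hx', y', hy', rfl⟩, sup_le_sup h₁ h₃, sup_le_sup h₂ h₄⟩)
    (by
      refine mem_of_le (sup_le ?_ ?_) h
      · refine (IsContinuousLattice.isLUB_wayBelow x).2 fun x' hx' => ?_
        obtain ⟨y', hy'⟩ := IsContinuousLattice.nonempty_wayBelow y
        exact le_sup_left.trans (le_sSup ⟨x', hx', y', hy', rfl⟩)
      · refine (IsContinuousLattice.isLUB_wayBelow y).2 fun y' hy' => ?_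
        obtain ⟨x', hx'⟩ := IsContinuousLattice.nonempty_wayBelow x
        exact le_sup_right.trans (le_sSup ⟨x', hx', y', hy', rfl⟩))
  obtain ⟨k, hxk, hk⟩ := exists_of_wayBelow hx'
  obtain ⟨l, hyl, hl⟩ := exists_of_wayBelow hy'
  exact ⟨k, l, hxk, hyl, fun z hz => mem_of_le (sup_le (hk z hz.1) (hl z hz.2)) hd⟩

/-- A Scott-open filter is the supremum of the Scott-open filters bounded below by one of its
elements. -/
theorem isLUB_of_lowerBound_mem (k : ScottOpenFilter L) :
    IsLUB {l : ScottOpenFilter L | ∃ x ∈ k.carrier, ∀ z ∈ l.carrier, x ≤ z} k := by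
  refine ⟨fun l ⟨x, hx, hl⟩ z hz => mem_of_le (hl z hz) hx, fun m hm x hx => ?_⟩
  obtain ⟨y, hy, -, l, hxl, hl, -⟩ := exists_between (k := k) hx
  exact hm ⟨y, hy, hl⟩ hxl

end ScottOpenFilter

end Continuous

section StablyContinuous

variable [IsStablyContinuousLattice L]

namespace ScottOpenFilter

variable (L) in
/-- The Scott-open filter whose only element is `⊤`. -/
def onlyTop : ScottOpenFilter L :=
  ofSet {⊤} rfl (fun x y h hx => by rw [Set.mem_singleton_iff] at *; exact top_le_iff.1 (hx ▸ h))
    (fun x hx y hy => by rw [Set.mem_singleton_iff] at *; simp [hx, hy])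
    (fun D hD hdir h => by
      obtain ⟨d, hd, hle⟩ := IsStablyContinuousLattice.top_wayBelow_top D hD hdir
        (Set.mem_singleton_iff.1 h).ge
      exact ⟨d, hd, top_le_iff.1 hle⟩)

theorem onlyTop_le (k : ScottOpenFilter L) : onlyTop L ≤ k := by
  rintro x (rfl : x = ⊤)
  exact k.top_mem

/-- The join of two Scott-open filters. -/
def join (k l : ScottOpenFilter L) : ScottOpenFilter L :=
  ofSet {z | ∃ a ∈ k.carrier, ∃ b ∈ l.carrier, a ⊓ b ≤ z} ⟨⊤, k.top_mem, ⊤, l.top_mem, le_top⟩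
    (fun _ _ h ⟨a, ha, b, hb, hz⟩ => ⟨a, ha, b, hb, hz.trans h⟩)
    (fun _ ⟨a, ha, b, hb, h⟩ _ ⟨a', ha', b', hb', h'⟩ =>
      ⟨a ⊓ a', inf_mem ha ha', b ⊓ b', inf_mem hb hb', le_inf
        ((inf_le_inf inf_le_left inf_le_left).trans h)
        ((inf_le_inf inf_le_right inf_le_right).trans h')⟩)
    (fun D hD hdir ⟨a, ha, b, hb, h⟩ => by
      obtain ⟨a', ha', haa⟩ := exists_wayBelow_mem ha
      obtain ⟨b', hb', hbb⟩ := exists_wayBelow_mem hb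
      -- Multiplicativity of the way-below relation is what makes the filter generated by `k` and
      -- `l` Scott-open.
      obtain ⟨d, hd, hle⟩ := IsStablyContinuousLattice.wayBelow_inf (a' ⊓ b') a b
        (haa.mono inf_le_left le_rfl) (hbb.mono inf_le_right le_rfl) D hD hdir h
      exact ⟨d, hd, a', ha', b', hb', hle⟩)

theorem inf_mem_join {k l : ScottOpenFilter L} {x y : L} (hx : x ∈ k.carrier)
    (hy : y ∈ l.carrier) : x ⊓ y ∈ (join k l).carrier := ⟨x, hx, y, hy, le_rfl⟩

theorem le_join_left (k l : ScottOpenFilter L) : k ≤ join k l :=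
  fun x hx => ⟨x, hx, ⊤, l.top_mem, inf_le_left⟩

theorem le_join_right (k l : ScottOpenFilter L) : l ≤ join k l :=
  fun x hx => ⟨⊤, k.top_mem, x, hx, inf_le_right⟩

theorem isLUB_join (k l : ScottOpenFilter L) : IsLUB {k, l} (join k l) := by
  refine ⟨?_, fun m hm => ?_⟩
  · rintro _ (rfl | rfl)
    · exact le_join_left _ _
    · exact le_join_right _ _
  · rintro z ⟨a, ha, b, hb, h⟩
    exact mem_of_le h (inf_mem (hm (a := k) (by simp) ha) (hm (a := l) (by simp) hb))

end ScottOpenFilter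

end StablyContinuous

end Filters

/-! ### Strong epimorphisms as covers. -/

section RegularEpi

variable {C : Type u} [Category.{v} C]

/-- A morphism that identifies every pair of generalised elements identified by a regular
epimorphism factors through it. -/
theorem exists_desc_of_isRegularEpi {A B D : C} (q : A ⟶ B) [IsRegularEpi q] (f : A ⟶ D)
    (h : ∀ ⦃T : C⦄ (a b : T ⟶ A), a ≫ q = b ≫ q → a ≫ f = b ≫ f) : ∃ g : B ⟶ D, q ≫ g = f :=
  ⟨IsRegularEpi.desc q f (h _ _ (IsRegularEpi.w q)), IsRegularEpi.fac q f _⟩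

variable [CategoryTheory.Regular C]

theorem exists_cover_lift {A B T : C} (q : A ⟶ B) [StrongEpi q] (b : T ⟶ B) :
    ∃ (T' : C) (p : T' ⟶ T) (_ : StrongEpi p) (a : T' ⟶ A), a ≫ q = p ≫ b :=
  ⟨pullback q b, pullback.snd q b, inferInstance, pullback.fst q b, pullback.condition⟩

end RegularEpi

section Image

variable {C : Type u} [Category.{v} C] [CategoryTheory.Regular C]

theorem strongEpi_factorThruImageSubobject {X Y : C} (f : X ⟶ Y) :
    StrongEpi (factorThruImageSubobject f) := by
  have : StrongEpi (factorThruImage f) := inferInstance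
  rw [factorThruImageSubobject]
  exact strongEpi_comp _ _

end Image

/-! ### Relations computed on generalised elements, with existence holding locally on a cover. -/

section Calculus

attribute [local simp] prod.lift_fst prod.lift_fst_assoc prod.lift_snd prod.lift_snd_assoc
  pullback.lift_fst_assoc pullback.lift_snd_assoc equalizer.lift_ι

variable {C : Type u} [Category.{v} C] [CategoryTheory.Regular C] {A : C}

/-- Two generalised elements of `A` are related by the relation `R` on `A`. -/
def Related (R : Subobject (A ⨯ A)) {T : C} (a b : T ⟶ A) : Prop :=
  R.Factors (prod.lift a b)

theorem related_iff {R : Subobject (A ⨯ A)} {T : C} {a b : T ⟶ A} :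
    Related R a b ↔ ∃ r : T ⟶ (R : C), r ≫ R.arrow ≫ prod.fst = a ∧ r ≫ R.arrow ≫ prod.snd = b := by
  constructor
  · intro h
    have h' : R.Factors (prod.lift a b) := h
    exact ⟨R.factorThru _ h', by simp, by simp⟩
  · rintro ⟨r, rfl, rfl⟩
    have h := Subobject.factors_comp_arrow (P := R) r
    rwa [show r ≫ R.arrow = prod.lift (r ≫ R.arrow ≫ prod.fst) (r ≫ R.arrow ≫ prod.snd) by
      ext <;> simp] at h

theorem Related.precomp {R : Subobject (A ⨯ A)} {T T' : C} {a b : T ⟶ A} (h : Related R a b)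
    (p : T' ⟶ T) : Related R (p ≫ a) (p ≫ b) := by
  obtain ⟨r, rfl, rfl⟩ := related_iff.1 h
  exact related_iff.2 ⟨p ≫ r, by simp, by simp⟩

theorem related_arrow (R : Subobject (A ⨯ A)) :
    Related R (R.arrow ≫ prod.fst) (R.arrow ≫ prod.snd) :=
  related_iff.2 ⟨𝟙 _, by simp, by simp⟩

theorem le_iff_related {R S : Subobject (A ⨯ A)} :
    R ≤ S ↔ ∀ ⦃T : C⦄ (a b : T ⟶ A), Related R a b → Related S a b := by
  constructor
  · intro h T a b hab
    exact Subobject.factors_of_le _ h hab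
  · intro h
    obtain ⟨r, h₁, h₂⟩ := related_iff.1 (h _ _ (related_arrow R))
    refine Subobject.le_of_comm r ?_
    ext
    · simpa using h₁
    · simpa using h₂

/-- Relatedness is local for strong epimorphisms. -/
theorem Related.of_cover {R : Subobject (A ⨯ A)} {T T' : C} {a b : T ⟶ A} (p : T' ⟶ T)
    [StrongEpi p] (h : Related R (p ≫ a) (p ≫ b)) : Related R a b := by
  obtain ⟨r, h₁, h₂⟩ := related_iff.1 h
  have sq : CommSq r p R.arrow (prod.lift a b) := ⟨by
    ext
    · simpa using h₁
    · simpa using h₂⟩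
  refine related_iff.2 ⟨sq.lift, ?_, ?_⟩
  · rw [← Category.assoc, sq.fac_right, prod.lift_fst]
  · rw [← Category.assoc, sq.fac_right, prod.lift_snd]

theorem related_imageSubobject_iff {X : C} {u v : X ⟶ A} {T : C} {a b : T ⟶ A} :
    Related (imageSubobject (prod.lift u v)) a b ↔
      ∃ (T' : C) (p : T' ⟶ T) (_ : StrongEpi p) (t : T' ⟶ X), t ≫ u = p ≫ a ∧ t ≫ v = p ≫ b := by
  constructor
  · intro h
    have h' : (imageSubobject (prod.lift u v)).Factors (prod.lift a b) := h
    have := strongEpi_factorThruImageSubobject (prod.lift u v)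
    obtain ⟨T', p, hp, t, ht⟩ := exists_cover_lift (factorThruImageSubobject (prod.lift u v))
      (Subobject.factorThru _ _ h')
    have key : t ≫ prod.lift u v = p ≫ prod.lift a b := by
      have := ht =≫ (imageSubobject (prod.lift u v)).arrow
      simpa only [Category.assoc, imageSubobject_arrow_comp, Subobject.factorThru_arrow] using this
    refine ⟨T', p, hp, t, ?_, ?_⟩
    · simpa using key =≫ prod.fst
    · simpa using key =≫ prod.snd
  · rintro ⟨T', p, hp, t, h₁, h₂⟩
    refine Related.of_cover p ?_
    rw [← h₁, ← h₂, Related, ← prod.comp_lift]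
    exact imageSubobject_factors_comp_self _ _

/-- The middle element exists only after passing to a cover, because the composite is defined as an
image. -/
theorem related_relComp_iff {R S : Subobject (A ⨯ A)} {T : C} {a b : T ⟶ A} :
    Related (relComp R S) a b ↔ ∃ (T' : C) (p : T' ⟶ T) (_ : StrongEpi p) (c : T' ⟶ A),
      Related R (p ≫ a) c ∧ Related S c (p ≫ b) := by
  rw [relComp, related_imageSubobject_iff]
  constructor
  · rintro ⟨T', p, hp, t, h₁, h₂⟩
    exact ⟨T', p, hp, t ≫ pullback.fst _ _ ≫ R.arrow ≫ prod.snd,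
      related_iff.2 ⟨t ≫ pullback.fst _ _, by simpa using h₁, by simp⟩,
      related_iff.2 ⟨t ≫ pullback.snd _ _, by simp [pullback.condition], by simpa using h₂⟩⟩
  · rintro ⟨T', p, hp, c, h₁, h₂⟩
    obtain ⟨r, hr₁, hr₂⟩ := related_iff.1 h₁
    obtain ⟨s, hs₁, hs₂⟩ := related_iff.1 h₂
    exact ⟨T', p, hp, pullback.lift r s (by rw [hr₂, hs₁]), by simpa using hr₁, by simpa using hs₂⟩

/-- A relation that is reflexive, symmetric and transitive on generalised elements is an
equivalence relation. -/
theorem isEquivalenceRelation_of_related {R : Subobject (A ⨯ A)}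
    (hrefl : ∀ ⦃T : C⦄ (a : T ⟶ A), Related R a a)
    (hsymm : ∀ ⦃T : C⦄ (a b : T ⟶ A), Related R a b → Related R b a)
    (htrans : ∀ ⦃T : C⦄ (a b c : T ⟶ A), Related R a b → Related R b c → Related R a c) :
    IsEquivalenceRelation (R.arrow ≫ prod.fst) (R.arrow ≫ prod.snd) := by
  obtain ⟨r, hr₁, hr₂⟩ := related_iff.1 (hrefl (𝟙 A))
  obtain ⟨s, hs₁, hs₂⟩ := related_iff.1 (hsymm _ _ (related_arrow R))
  obtain ⟨t, ht₁, ht₂⟩ := related_iff.1 (htrans _ _ _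
    ((related_arrow R).precomp (pullback.fst (R.arrow ≫ prod.snd) (R.arrow ≫ prod.fst)))
    (by
      have := (related_arrow R).precomp (pullback.snd (R.arrow ≫ prod.snd) (R.arrow ≫ prod.fst))
      rwa [← pullback.condition] at this))
  exact ⟨⟨{
    right_cancellation := fun Y f g h₁ h₂ => by
      rw [← cancel_mono R.arrow]
      ext
      · simpa using h₁
      · simpa using h₂
    r := r
    reflexivity₁ := hr₁
    reflexivity₂ := hr₂
    s := s
    symmetry₁ := hs₁
    symmetry₂ := hs₂
    c := pullback.cone _ _
    isLimit := pullback.isLimit _ _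
    t := t
    transitivity₁ := ht₁
    transitivity₂ := ht₂ }⟩⟩

namespace EquivRel

variable (R S : EquivRel A)

/-- Two generalised elements of `A` are related by the equivalence relation `R` on `A`. -/
abbrev Rel {T : C} (a b : T ⟶ A) : Prop := Related R.1 a b

variable {R S} {T : C} {a b c : T ⟶ A}

variable (R) in
theorem refl (a : T ⟶ A) : R.Rel a a := by
  obtain ⟨⟨e⟩⟩ := R.2
  exact related_iff.2 ⟨a ≫ e.r, by simp, by simp⟩

theorem Rel.symm (h : R.Rel a b) : R.Rel b a := by
  obtain ⟨⟨e⟩⟩ := R.2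
  obtain ⟨r, rfl, rfl⟩ := related_iff.1 h
  exact related_iff.2 ⟨r ≫ e.s, by simp [e.symmetry₁], by simp [e.symmetry₂]⟩

theorem Rel.trans (h : R.Rel a b) (h' : R.Rel b c) : R.Rel a c := by
  obtain ⟨⟨e⟩⟩ := R.2
  obtain ⟨r, rfl, rfl⟩ := related_iff.1 h
  obtain ⟨s, hs, rfl⟩ := related_iff.1 h'
  let x := PullbackCone.IsLimit.lift e.isLimit r s hs.symm
  refine related_iff.2 ⟨x ≫ e.t, ?_, ?_⟩
  · rw [Category.assoc, e.transitivity₁, ← Category.assoc, PullbackCone.IsLimit.lift_fst]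
  · rw [Category.assoc, e.transitivity₂, ← Category.assoc, PullbackCone.IsLimit.lift_snd]

theorem le_iff : R ≤ S ↔ ∀ ⦃T : C⦄ (a b : T ⟶ A), R.Rel a b → S.Rel a b :=
  le_iff_related

theorem relComp_le {E : EquivRel A} (hR : R ≤ E) (hS : S ≤ E) : relComp R.1 S.1 ≤ E.1 := by
  refine le_iff_related.2 fun T a b h => ?_
  obtain ⟨T', p, hp, c, h₁, h₂⟩ := related_relComp_iff.1 h
  exact Related.of_cover p (EquivRel.Rel.trans (R := E) (le_iff.1 hR _ _ h₁) (le_iff.1 hS _ _ h₂))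

/-- The composite of commuting equivalence relations. -/
def comp (R S : EquivRel A) (h : R.Commute S) : EquivRel A :=
  ⟨relComp R.1 S.1, by
    have hsymm : ∀ ⦃T : C⦄ (a b : T ⟶ A), Related (relComp R.1 S.1) a b →
        Related (relComp R.1 S.1) b a := by
      intro T a b hab
      rw [show relComp R.1 S.1 = relComp S.1 R.1 from h]
      obtain ⟨T', p, hp, c, h₁, h₂⟩ := related_relComp_iff.1 hab
      exact related_relComp_iff.2 ⟨T', p, hp, c, Rel.symm (R := S) h₂, Rel.symm (R := R) h₁⟩
    refine isEquivalenceRelation_of_related (fun T a => ?_) hsymm fun T a b c hab hbc => ?_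
    · exact related_relComp_iff.2 ⟨T, 𝟙 T, inferInstance, a, by simpa using R.refl a,
        by simpa using S.refl a⟩
    · obtain ⟨T₁, p₁, hp₁, d, had, hdb⟩ := related_relComp_iff.1 hab
      obtain ⟨T₂, p₂, hp₂, e, hbe, hec⟩ := related_relComp_iff.1 (hbc.precomp p₁)
      -- In the chain `a R d S b R e S c` the two middle steps are swapped by commutation into `d R
      -- f S e`; transitivity of `R` and of `S` then shortens the chain.
      have hde : Related (relComp R.1 S.1) (p₂ ≫ d) e := by
        rw [show relComp R.1 S.1 = relComp S.1 R.1 from h]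
        exact related_relComp_iff.2 ⟨T₂, 𝟙 _, inferInstance, p₂ ≫ p₁ ≫ b,
          by simpa using hdb.precomp p₂, by simpa using hbe⟩
      obtain ⟨T₃, p₃, hp₃, f, hdf, hfe⟩ := related_relComp_iff.1 hde
      have := strongEpi_comp p₂ p₁
      have := strongEpi_comp p₃ (p₂ ≫ p₁)
      refine related_relComp_iff.2 ⟨T₃, p₃ ≫ p₂ ≫ p₁, inferInstance, f, ?_, ?_⟩
      · exact Rel.trans (R := R) (by simpa using had.precomp (p₃ ≫ p₂)) hdf
      · exact Rel.trans (R := S) hfe (by simpa using hec.precomp p₃)⟩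

/-- The join of commuting equivalence relations is their composite. -/
theorem isLUB_comp (h : R.Commute S) : IsLUB {R, S} (comp R S h) := by
  refine ⟨?_, fun E hE => relComp_le (hE (by simp)) (hE (by simp))⟩
  rintro _ (rfl | rfl)
  · exact le_iff.2 fun T a b hab => related_relComp_iff.2 ⟨T, 𝟙 T, inferInstance, b,
      by simpa using hab, by simpa using S.refl b⟩
  · exact le_iff.2 fun T a b hab => related_relComp_iff.2 ⟨T, 𝟙 T, inferInstance, a,
      by simpa using R.refl a, by simpa using hab⟩

theorem related_mk_equalizer_iff {B : C} {q : A ⟶ B} :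
    Related (Subobject.mk (equalizer.ι (prod.fst ≫ q : A ⨯ A ⟶ B) (prod.snd ≫ q))) a b ↔
      a ≫ q = b ≫ q := by
  rw [Related, Subobject.mk_factors_iff]
  constructor
  · rintro ⟨t, ht⟩
    change T ⟶ equalizer (prod.fst ≫ q : A ⨯ A ⟶ B) (prod.snd ≫ q) at t
    change t ≫ equalizer.ι _ _ = _ at ht
    simpa [reassoc_of% ht] using t ≫= equalizer.condition (prod.fst ≫ q : A ⨯ A ⟶ B) (prod.snd ≫ q)
  · intro h
    exact ⟨equalizer.lift (prod.lift a b) (by simpa using h), by simp⟩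

/-- The kernel pair of a morphism, as an equivalence relation. -/
def ker {B : C} (q : A ⟶ B) : EquivRel A :=
  ⟨Subobject.mk (equalizer.ι (prod.fst ≫ q : A ⨯ A ⟶ B) (prod.snd ≫ q)),
    isEquivalenceRelation_of_related (fun _ _ => related_mk_equalizer_iff.2 rfl)
      (fun _ _ _ h => related_mk_equalizer_iff.2 (related_mk_equalizer_iff.1 h).symm)
      (fun _ _ _ _ h h' => related_mk_equalizer_iff.2
        ((related_mk_equalizer_iff.1 h).trans (related_mk_equalizer_iff.1 h')))⟩

@[simp]
theorem ker_rel_iff {B : C} {q : A ⟶ B} : (ker q).Rel a b ↔ a ≫ q = b ≫ q :=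
  related_mk_equalizer_iff

end EquivRel

end Calculus

/-! ### Quotients by equivalence relations. -/

section Quotient

variable {C : Type u} [Category.{v} C] [BarrExact C] {A : C} (R : EquivRel A)

namespace EquivRel

/-- Barr-exactness enters here: every equivalence relation is the kernel pair of its quotient map.
-/
theorem exists_quotient : ∃ (B : C) (q : A ⟶ B), IsRegularEpi q ∧
    ∀ ⦃T : C⦄ (a b : T ⟶ A), a ≫ q = b ≫ q ↔ R.Rel a b := by
  obtain ⟨⟨e⟩⟩ := BarrExact.isEffective _ _ R.2
  refine ⟨e.B, e.π, inferInstance, fun T a b => ⟨fun h => ?_, fun h => ?_⟩⟩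
  · exact related_iff.2 ⟨e.isKernelPair.lift a b h, by simp, by simp⟩
  · obtain ⟨r, rfl, rfl⟩ := related_iff.1 h
    simp only [Category.assoc]
    exact r ≫= (by simpa using e.isKernelPair.w)

/-- The quotient of an object by an equivalence relation. -/
def quot : C := R.exists_quotient.choose

/-- The quotient map. -/
def proj : A ⟶ R.quot := R.exists_quotient.choose_spec.choose

instance : IsRegularEpi R.proj := R.exists_quotient.choose_spec.choose_spec.1

variable {R} in
@[simp]
theorem comp_proj_eq_iff {T : C} {a b : T ⟶ A} : a ≫ R.proj = b ≫ R.proj ↔ R.Rel a b :=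
  R.exists_quotient.choose_spec.choose_spec.2 a b

@[simp]
theorem ker_proj : ker R.proj = R := by
  apply le_antisymm
  · exact le_iff.2 fun T a b h => comp_proj_eq_iff.1 (ker_rel_iff.1 h)
  · exact le_iff.2 fun T a b h => ker_rel_iff.2 (comp_proj_eq_iff.2 h)

variable {R}

theorem exists_desc {B : C} {f : A ⟶ B} (h : R ≤ ker f) : ∃ g : R.quot ⟶ B, R.proj ≫ g = f :=
  exists_desc_of_isRegularEpi _ _ fun _ a b hab =>
    ker_rel_iff.1 (le_iff.1 h a b (comp_proj_eq_iff.1 hab))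

/-- The morphism out of a quotient induced by a morphism with large enough kernel pair. -/
def desc {B : C} (f : A ⟶ B) (h : R ≤ ker f) : R.quot ⟶ B := (exists_desc h).choose

@[simp]
theorem proj_desc {B : C} (f : A ⟶ B) (h : R ≤ ker f) : R.proj ≫ desc f h = f :=
  (exists_desc h).choose_spec

/-- The canonical morphism between quotients. -/
def quotMap {S : EquivRel A} (h : R ≤ S) : R.quot ⟶ S.quot := desc S.proj (by simpa using h)

theorem proj_quotMap {S : EquivRel A} (h : R ≤ S) : R.proj ≫ quotMap h = S.proj :=
  proj_desc _ _

theorem proj_quotMap_assoc {S : EquivRel A} (h : R ≤ S)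
    {Z : C} (γ : _ ⟶ Z) :
    R.proj ≫ quotMap h ≫ γ =
      S.proj ≫ γ := by
  simp only [← Category.assoc, proj_quotMap]

theorem quotMap_comp {S E : EquivRel A} (h : R ≤ S) (h' : S ≤ E) :
    quotMap h ≫ quotMap h' = quotMap (h.trans h') := by
  rw [← cancel_epi R.proj]
  simp [proj_quotMap, proj_quotMap_assoc]

theorem quotMap_self (h : R ≤ R) : quotMap h = 𝟙 _ := by
  rw [← cancel_epi R.proj]
  simp [proj_quotMap]

end EquivRel

end Quotient

/-! ### Stalks of presheaves, and sections as limits of stalks. -/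

section Stalks

variable {C : Type u} [Category.{v} C] {L : Type v} [CompleteLattice L]

/-- The restriction morphism of a presheaf. -/
def res (F : Lᵒᵖ ⥤ C) {x y : L} (h : x ≤ y) : F.obj (op y) ⟶ F.obj (op x) :=
  F.map (homOfLE h).op

variable (F G : Lᵒᵖ ⥤ C)

@[simp]
theorem res_res {x y z : L} (h : x ≤ y) (h' : y ≤ z) :
    res F h' ≫ res F h = res F (h.trans h') := by
  rw [res, res, ← F.map_comp]
  rfl

@[simp]
theorem res_res_assoc {x y z : L} (h : x ≤ y) (h' : y ≤ z)
    {Z : C} (γ : _ ⟶ Z) :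
    res F h' ≫ res F h ≫ γ =
      res F (h.trans h') ≫ γ := by
  simp only [← Category.assoc, res_res]

@[simp]
theorem res_self {x : L} (h : x ≤ x) : res F h = 𝟙 _ := F.map_id _

variable {F G} in
theorem res_naturality (α : F ⟶ G) {x y : L} (h : x ≤ y) :
    res F h ≫ α.app (op x) = α.app (op y) ≫ res G h := α.naturality _

/-- The directed sheaf condition is applied to the elements way below `x`, whose supremum is `x`. -/
theorem eq_of_comp_res_wayBelow [IsContinuousLattice L] {F : Lᵒᵖ ⥤ C} (hF : IsOmegaSheaf F)
    {x : L} {T : C} {f g : T ⟶ F.obj (op x)}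
    (h : ∀ y (hy : WayBelow y x), f ≫ res F hy.le = g ≫ res F hy.le) : f = g := by
  obtain ⟨hlim⟩ := hF.isLimit _ (IsContinuousLattice.nonempty_wayBelow x)
    (IsContinuousLattice.directedOn_wayBelow x)
  have hx := sSup_wayBelow x
  have : f ≫ res F hx.le = g ≫ res F hx.le := hlim.hom_ext fun ⟨y, hy⟩ => by
    change (f ≫ res F _) ≫ res F _ = (g ≫ res F _) ≫ res F _
    simpa using h y hy
  have h' := this =≫ res F hx.ge
  simpa using h'

theorem exists_lift_of_wayBelow [IsContinuousLattice L] {F : Lᵒᵖ ⥤ C} (hF : IsOmegaSheaf F)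
    {x : L} {T : C} (s : ∀ y, WayBelow y x → (T ⟶ F.obj (op y)))
    (hs : ∀ y z hy hz (h : y ≤ z), s z hz ≫ res F h = s y hy) :
    ∃ f : T ⟶ F.obj (op x), ∀ y (hy : WayBelow y x), f ≫ res F hy.le = s y hy := by
  obtain ⟨hlim⟩ := hF.isLimit _ (IsContinuousLattice.nonempty_wayBelow x)
    (IsContinuousLattice.directedOn_wayBelow x)
  have hx := sSup_wayBelow x
  let c : Cone (restrict F {y | WayBelow y x}) :=
    { pt := T
      π :=
        { app := fun y => s y.unop.1 y.unop.2
          naturality := fun y z f => by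
            dsimp
            rw [Category.id_comp]
            exact (hs _ _ _ _ (leOfHom f.unop)).symm } }
  let g : T ⟶ F.obj (op (sSup {y | WayBelow y x})) := hlim.lift c
  refine ⟨g ≫ res F hx.ge, fun y hy => ?_⟩
  rw [Category.assoc, res_res]
  exact hlim.fac c (op ⟨y, hy⟩)

variable [HasColimits C]

/-- The colimit of a presheaf over a Scott-open filter. -/
def stalk (k : ScottOpenFilter L) : C := colimit (restrict F k.carrier)

/-- The canonical morphism to the colimit over a Scott-open filter. -/
def germ {k : ScottOpenFilter L} {x : L} (hx : x ∈ k.carrier) : F.obj (op x) ⟶ stalk F k :=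
  colimit.ι (restrict F k.carrier) (op ⟨x, hx⟩)

@[simp]
theorem res_germ {k : ScottOpenFilter L} {x y : L} (h : x ≤ y) (hx : x ∈ k.carrier) :
    res F h ≫ germ F hx = germ F (ScottOpenFilter.mem_of_le h hx) :=
  colimit.w (restrict F k.carrier)
    (homOfLE h : (⟨x, hx⟩ : k.carrier) ⟶ ⟨y, ScottOpenFilter.mem_of_le h hx⟩).op

@[simp]
theorem res_germ_assoc {k : ScottOpenFilter L} {x y : L} (h : x ≤ y) (hx : x ∈ k.carrier)
    {Z : C} (γ : _ ⟶ Z) :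
    res F h ≫ germ F hx ≫ γ =
      germ F (ScottOpenFilter.mem_of_le h hx) ≫ γ := by
  simp only [← Category.assoc, res_germ]

variable {F} in
theorem stalk_hom_ext {k : ScottOpenFilter L} {T : C} {f g : stalk F k ⟶ T}
    (h : ∀ x (hx : x ∈ k.carrier), germ F hx ≫ f = germ F hx ≫ g) : f = g :=
  colimit.hom_ext fun x => h x.unop.1 x.unop.2

/-- The morphism out of a stalk induced by a compatible family. -/
def stalkDesc (k : ScottOpenFilter L) {T : C} (f : ∀ x, x ∈ k.carrier → (F.obj (op x) ⟶ T))
    (hf : ∀ x y hx hy (h : x ≤ y), res F h ≫ f x hx = f y hy) : stalk F k ⟶ T :=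
  colimit.desc (restrict F k.carrier)
    { pt := T
      ι :=
        { app := fun x => f x.unop.1 x.unop.2
          naturality := fun x y g => by
            dsimp
            rw [Category.comp_id]
            exact hf _ _ _ _ (leOfHom g.unop) } }

@[simp]
theorem germ_stalkDesc {k : ScottOpenFilter L} {T : C}
    (f : ∀ x, x ∈ k.carrier → (F.obj (op x) ⟶ T)) (hf) {x : L} (hx : x ∈ k.carrier) :
    germ F hx ≫ stalkDesc F k f hf = f x hx :=
  colimit.ι_desc _ _

@[simp]
theorem germ_stalkDesc_assoc {k : ScottOpenFilter L} {T : C}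
    (f : ∀ x, x ∈ k.carrier → (F.obj (op x) ⟶ T)) (hf) {x : L} (hx : x ∈ k.carrier)
    {Z : C} (γ : _ ⟶ Z) :
    germ F hx ≫ stalkDesc F k f hf ≫ γ =
      f x hx ≫ γ := by
  simp only [← Category.assoc, germ_stalkDesc]

/-- The canonical morphism between stalks. -/
def stalkMap {k l : ScottOpenFilter L} (h : k ≤ l) : stalk F k ⟶ stalk F l :=
  stalkDesc F k (fun _ hx => germ F (ScottOpenFilter.mem_mono h hx))
    (fun _ _ _ _ _ => res_germ _ _ _)

@[simp]
theorem germ_stalkMap {k l : ScottOpenFilter L} (h : k ≤ l) {x : L} (hx : x ∈ k.carrier) :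
    germ F hx ≫ stalkMap F h = germ F (ScottOpenFilter.mem_mono h hx) := germ_stalkDesc _ _ _ _

@[simp]
theorem germ_stalkMap_assoc {k l : ScottOpenFilter L} (h : k ≤ l) {x : L} (hx : x ∈ k.carrier)
    {Z : C} (γ : _ ⟶ Z) :
    germ F hx ≫ stalkMap F h ≫ γ =
      germ F (ScottOpenFilter.mem_mono h hx) ≫ γ := by
  simp only [← Category.assoc, germ_stalkMap]

/-- The canonical morphism from the stalk at a Scott-open filter to the sections over a lower
bound of that filter. -/
def stalkRes {k : ScottOpenFilter L} {y : L} (h : ∀ x ∈ k.carrier, y ≤ x) :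
    stalk F k ⟶ F.obj (op y) :=
  stalkDesc F k (fun x hx => res F (h x hx)) (fun _ _ _ _ _ => res_res _ _ _)

@[simp]
theorem germ_stalkRes {k : ScottOpenFilter L} {y : L} (h : ∀ x ∈ k.carrier, y ≤ x)
    {x : L} (hx : x ∈ k.carrier) : germ F hx ≫ stalkRes F h = res F (h x hx) :=
  germ_stalkDesc _ _ _ _

@[simp]
theorem germ_stalkRes_assoc {k : ScottOpenFilter L} {y : L} (h : ∀ x ∈ k.carrier, y ≤ x)
    {x : L} (hx : x ∈ k.carrier)
    {Z : C} (γ : _ ⟶ Z) :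
    germ F hx ≫ stalkRes F h ≫ γ =
      res F (h x hx) ≫ γ := by
  simp only [← Category.assoc, germ_stalkRes]

-- A lower bound of `k` that belongs to `l` factors the map between their stalks through an actual
-- object of sections.
@[simp]
theorem stalkRes_germ {k l : ScottOpenFilter L} {y : L} (h : ∀ x ∈ k.carrier, y ≤ x)
    (hy : y ∈ l.carrier) : stalkRes F h ≫ germ F hy =
      stalkMap F (ScottOpenFilter.le_def.2 fun x hx => ScottOpenFilter.mem_of_le (h x hx) hy) :=
  stalk_hom_ext fun x hx => by simp

@[simp]
theorem stalkMap_stalkRes {k l : ScottOpenFilter L} (hkl : k ≤ l) {y : L}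
    (h : ∀ x ∈ l.carrier, y ≤ x) :
    stalkMap F hkl ≫ stalkRes F h =
      stalkRes F (fun x hx => h x (ScottOpenFilter.mem_mono hkl hx)) :=
  stalk_hom_ext fun x hx => by simp

@[simp]
theorem stalkRes_res {k : ScottOpenFilter L} {y z : L} (h : ∀ x ∈ k.carrier, y ≤ x)
    (hz : z ≤ y) : stalkRes F h ≫ res F hz = stalkRes F (fun x hx => hz.trans (h x hx)) :=
  stalk_hom_ext fun x hx => by simp

variable {F G}

/-- The morphism between stalks induced by a morphism of presheaves. -/
def stalkHom (α : F ⟶ G) (k : ScottOpenFilter L) : stalk F k ⟶ stalk G k :=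
  stalkDesc F k (fun x hx => α.app (op x) ≫ germ G hx) (fun x y hx hy h => by
    rw [← Category.assoc, res_naturality, Category.assoc, res_germ])

@[simp]
theorem germ_stalkHom (α : F ⟶ G) {k : ScottOpenFilter L} {x : L} (hx : x ∈ k.carrier) :
    germ F hx ≫ stalkHom α k = α.app (op x) ≫ germ G hx := germ_stalkDesc _ _ _ _

variable [IsContinuousLattice L]

/-- The sections of an Ω-sheaf over `x` are determined by their germs at the Scott-open filters
containing `x`. -/
theorem IsOmegaSheaf.hom_ext (hF : IsOmegaSheaf F) {x : L} {T : C} {f g : T ⟶ F.obj (op x)}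
    (h : ∀ (k : ScottOpenFilter L) (hx : x ∈ k.carrier), f ≫ germ F hx = g ≫ germ F hx) :
    f = g := by
  refine eq_of_comp_res_wayBelow hF fun y hy => ?_
  obtain ⟨k, hxk, hk⟩ := ScottOpenFilter.exists_of_wayBelow hy
  simpa using h k hxk =≫ stalkRes F hk

/-- The sections of an Ω-sheaf over `x` are the limit of its stalks at the Scott-open filters
containing `x`. -/
theorem IsOmegaSheaf.exists_lift (hF : IsOmegaSheaf F) {x : L} {T : C}
    (t : ∀ k : ScottOpenFilter L, x ∈ k.carrier → (T ⟶ stalk F k))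
    (ht : ∀ k l hk hl (h : k ≤ l), t k hk ≫ stalkMap F h = t l hl) :
    ∃ f : T ⟶ F.obj (op x), ∀ k (hk : x ∈ k.carrier), f ≫ germ F hk = t k hk := by
  choose κ hκ₁ hκ₂ using fun y (hy : WayBelow y x) => ScottOpenFilter.exists_of_wayBelow hy
  -- Two filters bounded below by `y` are compared through their intersection, which still contains
  -- `x`. Hence the section over `y` does not depend on the chosen filter.
  have indep : ∀ (y : L) (k l : ScottOpenFilter L) (hxk : x ∈ k.carrier) (hxl : x ∈ l.carrier)
      (hk : ∀ z ∈ k.carrier, y ≤ z) (hl : ∀ z ∈ l.carrier, y ≤ z),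
      t k hxk ≫ stalkRes F hk = t l hxl ≫ stalkRes F hl := by
    intro y k l hxk hxl hk hl
    rw [← ht (k.inter l) k ⟨hxk, hxl⟩ hxk (ScottOpenFilter.inter_le_left _ _),
      ← ht (k.inter l) l ⟨hxk, hxl⟩ hxl (ScottOpenFilter.inter_le_right _ _)]
    simp
  obtain ⟨f, hf⟩ := exists_lift_of_wayBelow hF
    (fun y hy => t (κ y hy) (hκ₁ y hy) ≫ stalkRes F (hκ₂ y hy))
    (fun y z hy hz h => by
      rw [Category.assoc, stalkRes_res]
      exact indep _ _ _ _ _ _ _)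
  refine ⟨f, fun k hk => ?_⟩
  obtain ⟨y, hy, hyx, l, hxl, hl, hlk⟩ := ScottOpenFilter.exists_between hk
  have h := hf y hyx =≫ germ F hy
  rw [indep y _ l (hκ₁ y hyx) hxl (hκ₂ y hyx) hl] at h
  simpa [ht l k hxl hk hlk] using h

end Stalks

/-! ### Morphisms of representations and their kernel pairs on stalks. -/

section Representations

variable {C : Type u} [Category.{v} C] [HasColimits C] {L : Type v} [CompleteLattice L] {A : C}

namespace OmegaSheafRep

/-- The canonical morphism from `A` to the stalks of a representation. -/
def toStalk (F : OmegaSheafRep L A) (k : ScottOpenFilter L) : A ⟶ stalk F.sheaf k :=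
  F.iso.hom ≫ germ F.sheaf k.top_mem

@[simp]
theorem toStalk_stalkMap (F : OmegaSheafRep L A) {k l : ScottOpenFilter L} (h : k ≤ l) :
    F.toStalk k ≫ stalkMap F.sheaf h = F.toStalk l := by
  simp [toStalk]

@[simp]
theorem toStalk_stalkMap_assoc (F : OmegaSheafRep L A) {k l : ScottOpenFilter L} (h : k ≤ l)
    {Z : C} (γ : _ ⟶ Z) :
    F.toStalk k ≫ stalkMap F.sheaf h ≫ γ =
      F.toStalk l ≫ γ := by
  simp only [← Category.assoc, toStalk_stalkMap]

theorem toStalk_stalkHom {F G : OmegaSheafRep L A} (α : F ⟶ G) (k : ScottOpenFilter L) :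
    F.toStalk k ≫ stalkHom α.nat k = G.toStalk k := by
  have := α.iso_comp
  rw [toStalk, Category.assoc, germ_stalkHom, reassoc_of% this, toStalk]

variable [CategoryTheory.Regular C]

theorem isRegularEpi_toStalk {F : OmegaSheafRep L A} (hF : IsSoft F.sheaf)
    (k : ScottOpenFilter L) : IsRegularEpi (F.toStalk k) := by
  have : IsRegularEpi (germ F.sheaf k.top_mem) := hF k
  have : StrongEpi (F.toStalk k) := strongEpi_comp _ _
  infer_instance

/-- The equivalence relation on `A` given by equality of germs at a Scott-open filter. -/
def stalkKer (F : OmegaSheafRep L A) (k : ScottOpenFilter L) : EquivRel A :=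
  EquivRel.ker (F.toStalk k)

theorem stalkKer_rel_iff {F : OmegaSheafRep L A} {k : ScottOpenFilter L} {T : C} {a b : T ⟶ A} :
    (F.stalkKer k).Rel a b ↔ a ≫ F.toStalk k = b ≫ F.toStalk k := EquivRel.ker_rel_iff

theorem stalkKer_mono (F : OmegaSheafRep L A) : Monotone F.stalkKer := fun k l h =>
  EquivRel.le_iff.2 fun T a b hab => by
    rw [stalkKer_rel_iff] at hab ⊢
    rw [← toStalk_stalkMap F h, reassoc_of% hab]

theorem stalkKer_le_of_hom {F G : OmegaSheafRep L A} (α : F ⟶ G) (k : ScottOpenFilter L) :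
    F.stalkKer k ≤ G.stalkKer k :=
  EquivRel.le_iff.2 fun T a b hab => by
    rw [stalkKer_rel_iff] at hab ⊢
    rw [← toStalk_stalkHom α, reassoc_of% hab]

variable [IsContinuousLattice L]

/-- The induced maps on stalks are determined because `A` covers the stalks of `F`, and a map into
`G` is determined by its germs. -/
theorem hom_subsingleton {F G : OmegaSheafRep L A} (hF : IsSoft F.sheaf) :
    Subsingleton (F ⟶ G) where
  allEq α β := by
    refine OmegaSheafRep.Hom.ext (NatTrans.ext (funext fun x => ?_))
    refine G.isOmegaSheaf.hom_ext fun k hk => ?_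
    have := isRegularEpi_toStalk hF k
    have h : stalkHom α.nat k = stalkHom β.nat k := by
      rw [← cancel_epi (F.toStalk k), toStalk_stalkHom, toStalk_stalkHom]
    have h' := germ F.sheaf hk ≫= h
    rwa [germ_stalkHom, germ_stalkHom] at h'

/-- The inclusions of kernel pairs induce maps between the stalks as quotients of `A`; these
assemble because the sections of `G` are limits of stalks. -/
theorem exists_hom {F G : OmegaSheafRep L A} (hF : IsSoft F.sheaf)
    (h : ∀ k, F.stalkKer k ≤ G.stalkKer k) : Nonempty (F ⟶ G) := by
  have hepi := isRegularEpi_toStalk hF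
  choose β hβ using fun k => exists_desc_of_isRegularEpi (F.toStalk k) (G.toStalk k)
    fun T a b hab => stalkKer_rel_iff.1 (EquivRel.le_iff.1 (h k) a b (stalkKer_rel_iff.2 hab))
  have hnat : ∀ k l (hkl : k ≤ l), stalkMap F.sheaf hkl ≫ β l = β k ≫ stalkMap G.sheaf hkl := by
    intro k l hkl
    rw [← cancel_epi (F.toStalk k), toStalk_stalkMap_assoc, hβ, reassoc_of% hβ, toStalk_stalkMap]
  choose α hα using fun x : L => G.isOmegaSheaf.exists_lift (x := x)
    (fun k hk => germ F.sheaf hk ≫ β k)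
    (fun k l hk hl hkl => by rw [Category.assoc, ← hnat, germ_stalkMap_assoc])
  refine ⟨{ nat := { app := fun x => α x.unop, naturality := fun x y f => ?_ }, iso_comp := ?_ }⟩
  · refine G.isOmegaSheaf.hom_ext fun k hk => ?_
    change (res F.sheaf (leOfHom f.unop) ≫ _) ≫ _ = (_ ≫ res G.sheaf (leOfHom f.unop)) ≫ _
    rw [Category.assoc, hα, res_germ_assoc, Category.assoc, res_germ, hα]
  · refine G.isOmegaSheaf.hom_ext fun k hk => ?_
    rw [Category.assoc, hα]
    exact (Category.assoc _ _ _).symm.trans (hβ k)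

end OmegaSheafRep

end Representations

/-! ### Stalks as directed colimits, and the pullback square of stalks. -/

section Along

variable {C : Type u} [Category.{v} C] {L : Type v} [CompleteLattice L] (F : Lᵒᵖ ⥤ C)
  {J : Type v} [PartialOrder J]

/-- The restriction of a presheaf along an antitone map, as a covariant diagram. -/
def along {u : J → L} (hu : Antitone u) : J ⥤ C where
  obj j := F.obj (op (u j))
  map f := res F (hu (leOfHom f))
  map_id _ := res_self F _
  map_comp _ _ := (res_res F _ _).symm

def alongRes {u w : J → L} (hu : Antitone u) (hw : Antitone w) (h : ∀ j, u j ≤ w j) :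
    along F hw ⟶ along F hu where
  app j := res F (h j)
  naturality _ _ _ := (res_res F _ _).trans (res_res F _ _).symm

variable [HasColimits C]

/-- The canonical morphism to the colimit along an antitone map. -/
def ιAlong {u : J → L} (hu : Antitone u) (j : J) :
    F.obj (op (u j)) ⟶ (colim : (J ⥤ C) ⥤ C).obj (along F hu) :=
  colimit.ι (along F hu) j

@[simp]
theorem res_ιAlong {u : J → L} (hu : Antitone u) {i j : J} (h : i ≤ j) :
    res F (hu h) ≫ ιAlong F hu j = ιAlong F hu i :=
  colimit.w (along F hu) (homOfLE h)

variable {F} in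
theorem colimAlong_hom_ext {u : J → L} {hu : Antitone u} {T : C}
    {f g : (colim : (J ⥤ C) ⥤ C).obj (along F hu) ⟶ T}
    (h : ∀ j, ιAlong F hu j ≫ f = ιAlong F hu j ≫ g) : f = g :=
  colimit.hom_ext h

/-- The canonical morphism from the colimit along an antitone map to a stalk. -/
def colimAlongDesc {u : J → L} (hu : Antitone u) {k : ScottOpenFilter L}
    (hk : ∀ j, u j ∈ k.carrier) : (colim : (J ⥤ C) ⥤ C).obj (along F hu) ⟶ stalk F k :=
  colimit.desc (along F hu)
    { pt := stalk F k
      ι :=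
        { app := fun j => germ F (hk j)
          naturality := fun _ _ f =>
            (res_germ F (hu (leOfHom f)) _).trans (Category.comp_id _).symm } }

@[simp]
theorem ιAlong_colimAlongDesc {u : J → L} (hu : Antitone u) {k : ScottOpenFilter L}
    (hk : ∀ j, u j ∈ k.carrier) (j : J) :
    ιAlong F hu j ≫ colimAlongDesc F hu hk = germ F (hk j) :=
  colimit.ι_desc _ _

@[simp]
theorem ιAlong_colimAlongDesc_assoc {u : J → L} (hu : Antitone u) {k : ScottOpenFilter L}
    (hk : ∀ j, u j ∈ k.carrier) (j : J)
    {Z : C} (γ : _ ⟶ Z) :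
    ιAlong F hu j ≫ colimAlongDesc F hu hk ≫ γ =
      germ F (hk j) ≫ γ := by
  simp only [← Category.assoc, ιAlong_colimAlongDesc]

theorem res_ιAlong_eq [IsDirected J (· ≤ ·)] {u : J → L} (hu : Antitone u) {x : L} {i j : J}
    (hi : u i ≤ x) (hj : u j ≤ x) :
    res F hi ≫ ιAlong F hu i = res F hj ≫ ιAlong F hu j := by
  obtain ⟨m, him, hjm⟩ := exists_ge_ge i j
  rw [← res_ιAlong F hu him, ← res_ιAlong F hu hjm, res_res_assoc, res_res_assoc]

/-- The stalk at a Scott-open filter is the colimit along any directed antitone map that is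
coinitial in the filter. -/
def colimAlongIso [IsDirected J (· ≤ ·)] {u : J → L} (hu : Antitone u) {k : ScottOpenFilter L}
    (hk : ∀ j, u j ∈ k.carrier) (hcof : ∀ x ∈ k.carrier, ∃ j, u j ≤ x) :
    (colim : (J ⥤ C) ⥤ C).obj (along F hu) ≅ stalk F k where
  hom := colimAlongDesc F hu hk
  inv := stalkDesc F k
    (fun x hx => res F (hcof x hx).choose_spec ≫ ιAlong F hu (hcof x hx).choose)
    (fun x y hx hy h => by
      rw [res_res_assoc]
      exact res_ιAlong_eq F hu _ _)
  hom_inv_id := colimAlong_hom_ext fun j => by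
    rw [ιAlong_colimAlongDesc_assoc, germ_stalkDesc, Category.comp_id,
      res_ιAlong_eq F hu _ (le_refl (u j)), res_self, Category.id_comp]
  inv_hom_id := stalk_hom_ext fun x hx => by
    rw [germ_stalkDesc_assoc, Category.assoc, ιAlong_colimAlongDesc, res_germ, Category.comp_id]

theorem colimMap_alongRes_comp [IsDirected J (· ≤ ·)] {u w : J → L} (hu : Antitone u)
    (hw : Antitone w) (h : ∀ j, u j ≤ w j) {k l : ScottOpenFilter L} (hkl : l ≤ k)
    (huk : ∀ j, u j ∈ k.carrier) (hwl : ∀ j, w j ∈ l.carrier)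
    (hu' : ∀ x ∈ k.carrier, ∃ j, u j ≤ x) (hw' : ∀ x ∈ l.carrier, ∃ j, w j ≤ x) :
    colim.map (alongRes F hu hw h) ≫ (colimAlongIso F hu huk hu').hom =
      (colimAlongIso F hw hwl hw').hom ≫ stalkMap F hkl :=
  colimAlong_hom_ext fun j => by
    have hι : ιAlong F hw j ≫ colim.map (alongRes F hu hw h) = res F (h j) ≫ ιAlong F hu j :=
      colimit.ι_map _ _
    rw [reassoc_of% hι]
    simp [colimAlongIso]

end Along

section Stalks

variable {C : Type u} [Category.{v} C] [HasColimits C] {L : Type v}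
  [CompleteLattice L] [IsStablyContinuousLattice L]

open ScottOpenFilter in
-- The pullback squares of the pairs $(x, y) \in k \times l$ form a directed diagram, and their
-- colimit is again a pullback. The elements $x \vee y$, $x$, $y$ and $x \wedge y$ are coinitial in
-- $k \cap l$, $k$, $l$ and $k \vee l$, so the corners of the colimit are the stalks there.
theorem IsOmegaSheaf.isPullback_stalk (hC : DirectedColimitsCommuteWithFiniteLimits C)
    {F : Lᵒᵖ ⥤ C} (hF : IsOmegaSheaf F) (k l : ScottOpenFilter L) :
    IsPullback (stalkMap F (inter_le_left k l)) (stalkMap F (inter_le_right k l))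
      (stalkMap F (le_join_left k l)) (stalkMap F (le_join_right k l)) := by
  let J := (k.carrier × l.carrier)ᵒᵈ
  have : Nonempty J := ⟨OrderDual.toDual (⟨⊤, k.top_mem⟩, ⟨⊤, l.top_mem⟩)⟩
  have hJ : IsDirected J (· ≤ ·) := ⟨fun a b =>
    ⟨OrderDual.toDual (⟨(OrderDual.ofDual a).1.1 ⊓ (OrderDual.ofDual b).1.1,
        inf_mem (OrderDual.ofDual a).1.2 (OrderDual.ofDual b).1.2⟩,
      ⟨(OrderDual.ofDual a).2.1 ⊓ (OrderDual.ofDual b).2.1,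
        inf_mem (OrderDual.ofDual a).2.2 (OrderDual.ofDual b).2.2⟩),
      ⟨inf_le_left (a := (OrderDual.ofDual a).1.1), inf_le_left (a := (OrderDual.ofDual a).2.1)⟩,
      ⟨inf_le_right (a := (OrderDual.ofDual a).1.1),
        inf_le_right (a := (OrderDual.ofDual a).2.1)⟩⟩⟩
  have := hC J hJ
  let x : J → L := fun j => (OrderDual.ofDual j).1.1
  let y : J → L := fun j => (OrderDual.ofDual j).2.1
  have hx : Antitone x := fun a b h => h.1
  have hy : Antitone y := fun a b h => h.2
  have hsup : Antitone fun j => x j ⊔ y j := fun a b h => sup_le_sup (hx h) (hy h)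
  have hinf : Antitone fun j => x j ⊓ y j := fun a b h => inf_le_inf (hx h) (hy h)
  have sq : IsPullback (alongRes F hx hsup fun j => le_sup_left)
      (alongRes F hy hsup fun j => le_sup_right) (alongRes F hinf hx fun j => inf_le_left)
      (alongRes F hinf hy fun j => inf_le_right) :=
    IsPullback.of_forall_isPullback_app fun j => hF.isPullback (x j) (y j)
  refine (sq.map colim).of_iso (colimAlongIso F hsup (k := inter k l) ?_ ?_)
    (colimAlongIso F hx (k := k) ?_ ?_) (colimAlongIso F hy (k := l) ?_ ?_)
    (colimAlongIso F hinf (k := join k l) ?_ ?_) ?_ ?_ ?_ ?_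
  · exact fun j => ⟨mem_of_le le_sup_left (OrderDual.ofDual j).1.2,
      mem_of_le le_sup_right (OrderDual.ofDual j).2.2⟩
  -- An element of the intersection is reached by the diagonal pair.
  · exact fun z hz => ⟨OrderDual.toDual (⟨z, hz.1⟩, ⟨z, hz.2⟩), (sup_idem z).le⟩
  · exact fun j => (OrderDual.ofDual j).1.2
  · exact fun z hz => ⟨OrderDual.toDual (⟨z, hz⟩, ⟨⊤, l.top_mem⟩), le_rfl⟩
  · exact fun j => (OrderDual.ofDual j).2.2
  · exact fun z hz => ⟨OrderDual.toDual (⟨⊤, k.top_mem⟩, ⟨z, hz⟩), le_rfl⟩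
  · exact fun j => inf_mem_join (OrderDual.ofDual j).1.2 (OrderDual.ofDual j).2.2
  · exact fun z ⟨a, ha, b, hb, h⟩ => ⟨OrderDual.toDual (⟨a, ha⟩, ⟨b, hb⟩), h⟩
  all_goals exact colimMap_alongRes_comp F _ _ _ _ _ _ _ _

end Stalks

/-! ### From soft representations to commuting maps. -/

namespace OmegaSheafRep

open ScottOpenFilter

variable {C : Type u} [Category.{v} C] [HasColimits C] {L : Type v}
  [CompleteLattice L] {A : C}

section Regular

variable [CategoryTheory.Regular C] (F : OmegaSheafRep L A)

/-- The identity of the stalk at `all L` factors through the sections over `⊥`, which are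
subterminal. -/
theorem le_stalkKer_all (E : EquivRel A) : E ≤ F.stalkKer (all L) :=
  EquivRel.le_iff.2 fun T a b _ => by
    rw [stalkKer_rel_iff]
    have hid : stalkRes F.sheaf (fun x _ => bot_le) ≫ germ F.sheaf (mem_all ⊥) = 𝟙 _ :=
      stalk_hom_ext fun x hx => by simp
    rw [← Category.comp_id (F.toStalk _), ← hid]
    simp only [← Category.assoc]
    congr 1
    exact F.isOmegaSheaf.subterminal _ _

theorem stalkKer_onlyTop_le [IsStablyContinuousLattice L] (E : EquivRel A) :
    F.stalkKer (onlyTop L) ≤ E :=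
  EquivRel.le_iff.2 fun T a b hab => by
    rw [stalkKer_rel_iff] at hab
    have h := hab =≫ stalkRes F.sheaf (y := ⊤) (fun x hx => (show x = ⊤ from hx).ge)
    have h' : a = b := by
      rw [← cancel_mono F.iso.hom]
      simpa [toStalk] using h
    rw [h']
    exact E.refl b

variable [IsStablyContinuousLattice L] (hC : DirectedColimitsCommuteWithFiniteLimits C)
include hC

theorem le_stalkKer_inter {k l : ScottOpenFilter L} {E : EquivRel A} (hk : E ≤ F.stalkKer k)
    (hl : E ≤ F.stalkKer l) : E ≤ F.stalkKer (inter k l) :=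
  EquivRel.le_iff.2 fun T a b hab => by
    have h₁ := stalkKer_rel_iff.1 (EquivRel.le_iff.1 hk a b hab)
    have h₂ := stalkKer_rel_iff.1 (EquivRel.le_iff.1 hl a b hab)
    rw [stalkKer_rel_iff]
    exact (F.isOmegaSheaf.isPullback_stalk hC k l).hom_ext (by simpa using h₁) (by simpa using h₂)

variable {F} (hF : IsSoft F.sheaf)
include hF

/-- If `a` and `b` agree in the stalk at the join, the germ of `a` at `k` and that of `b` at `l`
glue to a germ at the intersection. By softness it lifts on a cover to an element `c` of `A`, the
required middle element. -/
theorem stalkKer_join_le_relComp (k l : ScottOpenFilter L) :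
    (F.stalkKer (join k l)).1 ≤ relComp (F.stalkKer k).1 (F.stalkKer l).1 :=
  le_iff_related.2 fun T a b hab => by
    have h := stalkKer_rel_iff.1 hab
    let t := (F.isOmegaSheaf.isPullback_stalk hC k l).lift (a ≫ F.toStalk k) (b ≫ F.toStalk l)
      (by simpa using h)
    have := isRegularEpi_toStalk hF (inter k l)
    obtain ⟨T', p, hp, c, hc⟩ := exists_cover_lift (F.toStalk (inter k l)) t
    refine related_relComp_iff.2 ⟨T', p, hp, c, stalkKer_rel_iff.2 ?_, stalkKer_rel_iff.2 ?_⟩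
    · have := hc =≫ stalkMap F.sheaf (inter_le_left k l)
      simpa [t] using this.symm
    · have := hc =≫ stalkMap F.sheaf (inter_le_right k l)
      simpa [t] using this

theorem relComp_stalkKer (k l : ScottOpenFilter L) :
    relComp (F.stalkKer k).1 (F.stalkKer l).1 = (F.stalkKer (join k l)).1 :=
  le_antisymm (EquivRel.relComp_le (F.stalkKer_mono (le_join_left k l))
    (F.stalkKer_mono (le_join_right k l))) (stalkKer_join_le_relComp hC hF k l)

theorem commute_stalkKer (k l : ScottOpenFilter L) :
    (F.stalkKer k).Commute (F.stalkKer l) := by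
  have h : join k l = join l k :=
    (isLUB_join k l).unique (by rw [Set.pair_comm]; exact isLUB_join l k)
  rw [EquivRel.Commute, relComp_stalkKer hC hF, relComp_stalkKer hC hF, h]

theorem stalkKer_join_le {k l : ScottOpenFilter L} {E : EquivRel A} (hk : F.stalkKer k ≤ E)
    (hl : F.stalkKer l ≤ E) : F.stalkKer (join k l) ≤ E :=
  (stalkKer_join_le_relComp hC hF k l).trans (EquivRel.relComp_le hk hl)

end Regular

section Exact

variable [BarrExact C] {F : OmegaSheafRep L A} (hF : IsSoft F.sheaf)
include hF

/-- The projection from `A` to its quotient by `E` factors through the stalk at each `k` in `D`. The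
factorisations are compatible and glue over the union, and `E` is the kernel pair of that
projection. -/
theorem stalkKer_sUnion_le {D : Set (ScottOpenFilter L)} (hD : D.Nonempty)
    (hdir : DirectedOn (· ≤ ·) D) {E : EquivRel A} (hE : ∀ k ∈ D, F.stalkKer k ≤ E) :
    F.stalkKer (sUnion D hD hdir) ≤ E := by
  have hepi := isRegularEpi_toStalk hF
  choose f hf using fun (k : ScottOpenFilter L) (hk : k ∈ D) =>
    exists_desc_of_isRegularEpi (F.toStalk k) E.proj fun T a b hab =>
      EquivRel.comp_proj_eq_iff.2 (EquivRel.le_iff.1 (hE k hk) a b (stalkKer_rel_iff.2 hab))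
  have hmap : ∀ k l hk hl (h : k ≤ l), stalkMap F.sheaf h ≫ f l hl = f k hk := by
    intro k l hk hl h
    rw [← cancel_epi (F.toStalk k), toStalk_stalkMap_assoc, hf, hf]
  have indep : ∀ k l hk hl x (hxk : x ∈ k.carrier) (hxl : x ∈ l.carrier),
      germ F.sheaf hxk ≫ f k hk = germ F.sheaf hxl ≫ f l hl := by
    intro k l hk hl x hxk hxl
    obtain ⟨m, hm, hkm, hlm⟩ := hdir k hk l hl
    rw [← hmap k m hk hm hkm, ← hmap l m hl hm hlm, germ_stalkMap_assoc, germ_stalkMap_assoc]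
  choose κ hκ hxκ using fun x (hx : x ∈ (sUnion D hD hdir).carrier) => mem_sUnion.1 hx
  let g := stalkDesc F.sheaf (sUnion D hD hdir)
    (fun x hx => germ F.sheaf (hxκ x hx) ≫ f (κ x hx) (hκ x hx))
    (fun x y hx hy h => by
      rw [res_germ_assoc]
      exact indep _ _ _ _ _ _ _)
  have hg : F.toStalk (sUnion D hD hdir) ≫ g = E.proj := by
    rw [toStalk, Category.assoc, germ_stalkDesc]
    exact (Category.assoc _ _ _).symm.trans (hf _ _)
  refine EquivRel.le_iff.2 fun T a b hab => EquivRel.comp_proj_eq_iff.1 ?_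
  rw [← hg, reassoc_of% stalkKer_rel_iff.1 hab]

/-- The commuting map associated with a soft representation. -/
def commutingMap [IsStablyContinuousLattice L]
    (hC : DirectedColimitsCommuteWithFiniteLimits C) : CommutingMap L A :=
  ⟨⟨F.stalkKer, F.stalkKer_mono⟩,
    preservesFiniteInfima_of_binary F.stalkKer_mono ⟨all L, F.le_stalkKer_all⟩
      (fun k l => ⟨inter k l, inter_le_left k l, inter_le_right k l,
        fun _ => F.le_stalkKer_inter hC⟩),
    preservesSuprema_of_directed F.stalkKer_mono ⟨onlyTop L, F.stalkKer_onlyTop_le⟩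
      (fun k l => ⟨join k l, le_join_left k l, le_join_right k l,
        fun _ => stalkKer_join_le hC hF⟩)
      (fun D hD hdir => ⟨sUnion D hD hdir, fun _ hk => le_sUnion hk,
        fun _ hE => stalkKer_sUnion_le hF hD hdir fun k hk => hE ⟨k, hk, rfl⟩⟩),
    commute_stalkKer hC hF⟩

end Exact

end OmegaSheafRep

/-! ### Extremal, meet and commuting equivalence relations on generalised elements. -/

namespace EquivRel

variable {C : Type u} [Category.{v} C] [BarrExact C] {A : C}

theorem rel_of_isTop {E : EquivRel A} (hE : ∀ R, R ≤ E) {T : C} (a b : T ⟶ A) : E.Rel a b :=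
  le_iff.1 (hE (ker (terminal.from A))) a b (ker_rel_iff.2 (Subsingleton.elim _ _))

theorem eq_of_rel_of_isBot {E : EquivRel A} (hE : ∀ R, E ≤ R) {T : C} {a b : T ⟶ A}
    (h : E.Rel a b) : a = b := by
  simpa using le_iff.1 (hE (ker (𝟙 A))) a b h

/-- The kernel pair of the map into the product of the two quotients is a lower bound of `R` and
`S`, hence below `I`. -/
theorem rel_of_isGLB {R S I : EquivRel A} (h : IsGLB {R, S} I) {T : C} {a b : T ⟶ A}
    (hR : R.Rel a b) (hS : S.Rel a b) : I.Rel a b := by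
  have hle : ker (prod.lift R.proj S.proj) ≤ I := h.2 <| by
    rintro _ (rfl | rfl)
    · exact le_iff.2 fun T a b hab => comp_proj_eq_iff.1 (by
        simpa [prod.lift_fst] using ker_rel_iff.1 hab =≫ prod.fst)
    · exact le_iff.2 fun T a b hab => comp_proj_eq_iff.1 (by
        simpa [prod.lift_snd] using ker_rel_iff.1 hab =≫ prod.snd)
  refine le_iff.1 hle a b (ker_rel_iff.2 ?_)
  ext
  · simpa [prod.lift_fst] using comp_proj_eq_iff.2 hR
  · simpa [prod.lift_snd] using comp_proj_eq_iff.2 hS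

/-- Two generalised elements of a quotient of `A` lift to `A` along a common cover. -/
theorem exists_lift_lift (R S : EquivRel A) {T : C} (f : T ⟶ R.quot) (g : T ⟶ S.quot) :
    ∃ (T' : C) (p : T' ⟶ T) (_ : StrongEpi p) (a b : T' ⟶ A),
      a ≫ R.proj = p ≫ f ∧ b ≫ S.proj = p ≫ g := by
  obtain ⟨T₁, p₁, _, a, ha⟩ := exists_cover_lift R.proj f
  obtain ⟨T₂, p₂, _, b, hb⟩ := exists_cover_lift S.proj (p₁ ≫ g)
  exact ⟨T₂, p₂ ≫ p₁, strongEpi_comp _ _, p₂ ≫ a, b, by simp [ha], by simp [hb]⟩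

theorem isSubterminal_quot {E : EquivRel A} (hE : ∀ R, R ≤ E) : IsSubterminal E.quot := by
  intro T f g
  obtain ⟨T', p, _, a, b, ha, hb⟩ := exists_lift_lift E E f g
  rw [← cancel_epi p, ← ha, ← hb]
  exact comp_proj_eq_iff.2 (rel_of_isTop hE a b)

theorem isIso_proj {E : EquivRel A} (hE : ∀ R, E ≤ R) : IsIso E.proj := by
  have : Mono E.proj := ⟨fun a b h => eq_of_rel_of_isBot hE (comp_proj_eq_iff.1 h)⟩
  exact isIso_of_mono_of_strongEpi _

theorem quot_hom_ext {R S I : EquivRel A} (h : IsGLB {R, S} I) (hR : I ≤ R) (hS : I ≤ S)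
    {T : C} {f g : T ⟶ I.quot} (h₁ : f ≫ quotMap hR = g ≫ quotMap hR)
    (h₂ : f ≫ quotMap hS = g ≫ quotMap hS) : f = g := by
  obtain ⟨T', p, _, a, b, ha, hb⟩ := exists_lift_lift I I f g
  rw [← cancel_epi p, ← ha, ← hb]
  refine comp_proj_eq_iff.2 (rel_of_isGLB h (comp_proj_eq_iff.1 ?_) (comp_proj_eq_iff.1 ?_))
  · rw [← proj_quotMap hR, reassoc_of% ha, reassoc_of% hb, h₁]
  · rw [← proj_quotMap hS, reassoc_of% ha, reassoc_of% hb, h₂]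

/-- The Chinese remainder theorem for commuting equivalence relations. -/
theorem exists_quot_lift {R S I J : EquivRel A} (hc : R.Commute S) (hI : IsGLB {R, S} I)
    (hJ : IsLUB {R, S} J) (hIR : I ≤ R) (hIS : I ≤ S) (hRJ : R ≤ J) (hSJ : S ≤ J) {T : C}
    {f : T ⟶ R.quot} {g : T ⟶ S.quot} (h : f ≫ quotMap hRJ = g ≫ quotMap hSJ) :
    ∃ u : T ⟶ I.quot, u ≫ quotMap hIR = f ∧ u ≫ quotMap hIS = g := by
  obtain ⟨T₁, p₁, _, a, b, ha, hb⟩ := exists_lift_lift R S f g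
  have hab : J.Rel a b := comp_proj_eq_iff.1 (by
    rw [← proj_quotMap hRJ, reassoc_of% ha, h, ← reassoc_of% hb, proj_quotMap hSJ,
      proj_quotMap hRJ])
  rw [hJ.unique (isLUB_comp hc)] at hab
  obtain ⟨T₂, p₂, _, c, hac, hcb⟩ := related_relComp_iff.1 hab
  have hac' := comp_proj_eq_iff.2 hac
  have hcb' := comp_proj_eq_iff.2 hcb
  -- The solution `c` exists only on a cover of `T`; since the quotient by `I` embeds in the
  -- product, it descends to `T` by lifting a strong epimorphism against a monomorphism.
  have : Mono (prod.lift (quotMap hIR) (quotMap hIS)) := ⟨fun x y hxy =>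
    quot_hom_ext hI hIR hIS (by simpa [prod.lift_fst] using hxy =≫ prod.fst)
      (by simpa [prod.lift_snd] using hxy =≫ prod.snd)⟩
  have := strongEpi_comp p₂ p₁
  have sq : CommSq (c ≫ I.proj) (p₂ ≫ p₁) (prod.lift (quotMap hIR) (quotMap hIS))
      (prod.lift f g) := ⟨by
    ext
    · simp [prod.lift_fst, proj_quotMap, ← hac', ha]
    · simp [prod.lift_snd, proj_quotMap, hcb', hb]⟩
  exact ⟨sq.lift, by simpa [prod.lift_fst] using sq.fac_right =≫ prod.fst,
    by simpa [prod.lift_snd] using sq.fac_right =≫ prod.snd⟩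

end EquivRel

open ScottOpenFilter EquivRel

/-! ### The presheaf of sections of a monotone map. -/

section Sections

variable {C : Type u} [Category.{v} C] [BarrExact C] {L : Type v}
  [CompleteLattice L] {A : C} (H : ScottOpenFilter L →o EquivRel A)

/-- The canonical morphism between the quotients of `A` by two values of a monotone map. -/
def valueMap {k l : ScottOpenFilter L} (h : k ≤ l) : (H k).quot ⟶ (H l).quot :=
  quotMap (H.monotone h)

@[simp]
theorem proj_valueMap {k l : ScottOpenFilter L} (h : k ≤ l) :
    (H k).proj ≫ valueMap H h = (H l).proj :=
  proj_quotMap _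

@[simp]
theorem proj_valueMap_assoc {k l : ScottOpenFilter L} (h : k ≤ l)
    {Z : C} (γ : _ ⟶ Z) :
    (H k).proj ≫ valueMap H h ≫ γ =
      (H l).proj ≫ γ := by
  simp only [← Category.assoc, proj_valueMap]

@[simp]
theorem valueMap_comp {k l m : ScottOpenFilter L} (h : k ≤ l) (h' : l ≤ m) :
    valueMap H h ≫ valueMap H h' = valueMap H (h.trans h') :=
  quotMap_comp _ _

/-- The quotients of `A` by the values of a monotone map. -/
def quotFunctor : ScottOpenFilter L ⥤ C where
  obj k := (H k).quot
  map f := valueMap H (leOfHom f)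
  map_id _ := quotMap_self _
  map_comp _ _ := (valueMap_comp _ _ _).symm

/-- The diagram of the quotients of `A` at the Scott-open filters containing `x`. -/
abbrev quotDiagram (x : L) : {k : ScottOpenFilter L // x ∈ k.carrier} ⥤ C :=
  (Subtype.mono_coe _).functor ⋙ quotFunctor H

variable [HasLimits C]

/-- The projection from the sections over `x` to the quotient at a Scott-open filter. -/
def limitπ {x : L} {k : ScottOpenFilter L} (hx : x ∈ k.carrier) :
    limit (quotDiagram H x) ⟶ (H k).quot :=
  limit.π (quotDiagram H x) ⟨k, hx⟩

/-- The restriction morphism between sections. -/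
def limitRes {x y : L} (h : x ≤ y) : limit (quotDiagram H y) ⟶ limit (quotDiagram H x) :=
  limit.lift (quotDiagram H x)
    { pt := limit (quotDiagram H y)
      π :=
        { app := fun k => limitπ H (mem_of_le h k.2)
          naturality := fun k l g => (Category.id_comp _).trans
            (limit.w (quotDiagram H y) (j := ⟨k.1, mem_of_le h k.2⟩)
              (j' := ⟨l.1, mem_of_le h l.2⟩) (homOfLE (leOfHom g))).symm } }

theorem limitRes_π {x y : L} (h : x ≤ y) {k : ScottOpenFilter L} (hx : x ∈ k.carrier) :
    limitRes H h ≫ limitπ H hx = limitπ H (mem_of_le h hx) :=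
  limit.lift_π _ _

variable {H} in
theorem limit_quotDiagram_hom_ext {x : L} {T : C} {f g : T ⟶ limit (quotDiagram H x)}
    (h : ∀ (k : ScottOpenFilter L) (hx : x ∈ k.carrier), f ≫ limitπ H hx = g ≫ limitπ H hx) :
    f = g :=
  limit.hom_ext fun k => h k.1 k.2

/-- The presheaf of sections: its value at `x` is the limit of the quotients of `A` at the
Scott-open filters containing `x`. -/
def quotSheaf : Lᵒᵖ ⥤ C where
  obj x := limit (quotDiagram H x.unop)
  map f := limitRes H (leOfHom f.unop)
  map_id x := limit_quotDiagram_hom_ext fun k hk => by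
    rw [limitRes_π, Category.id_comp]
  map_comp f g := limit_quotDiagram_hom_ext fun k hk => by
    rw [Category.assoc, limitRes_π, limitRes_π, limitRes_π]

/-- The projection from the sections over `x` to the quotient at a Scott-open filter. -/
def sectionsπ {x : L} {k : ScottOpenFilter L} (hx : x ∈ k.carrier) :
    (quotSheaf H).obj (op x) ⟶ (H k).quot :=
  limitπ H hx

@[simp]
theorem sectionsπ_valueMap {x : L} {k l : ScottOpenFilter L} (hx : x ∈ k.carrier) (h : k ≤ l) :
    sectionsπ H hx ≫ valueMap H h = sectionsπ H (mem_mono h hx) :=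
  limit.w (quotDiagram H x) (j := ⟨k, hx⟩) (j' := ⟨l, mem_mono h hx⟩) (homOfLE h)

@[simp]
theorem res_sectionsπ {x y : L} (h : x ≤ y) {k : ScottOpenFilter L} (hx : x ∈ k.carrier) :
    res (quotSheaf H) h ≫ sectionsπ H hx = sectionsπ H (mem_of_le h hx) :=
  limitRes_π H h hx

variable {H} in
theorem sections_hom_ext {x : L} {T : C} {f g : T ⟶ (quotSheaf H).obj (op x)}
    (h : ∀ (k : ScottOpenFilter L) (hx : x ∈ k.carrier), f ≫ sectionsπ H hx = g ≫ sectionsπ H hx) :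
    f = g :=
  limit_quotDiagram_hom_ext h

/-- The morphism to the sections induced by a compatible family. -/
def sectionsLift {x : L} {T : C} (f : ∀ k : ScottOpenFilter L, x ∈ k.carrier → (T ⟶ (H k).quot))
    (hf : ∀ k l hk hl (h : k ≤ l), f k hk ≫ valueMap H h = f l hl) :
    T ⟶ (quotSheaf H).obj (op x) :=
  limit.lift (quotDiagram H x)
    { pt := T
      π :=
        { app := fun k => f k.1 k.2
          naturality := fun k l g =>
            (Category.id_comp _).trans (hf k.1 l.1 k.2 l.2 (leOfHom g)).symm } }

@[simp]
theorem sectionsLift_π {x : L} {T : C}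
    (f : ∀ k : ScottOpenFilter L, x ∈ k.carrier → (T ⟶ (H k).quot)) (hf)
    {k : ScottOpenFilter L} (hx : x ∈ k.carrier) :
    sectionsLift H f hf ≫ sectionsπ H hx = f k hx :=
  limit.lift_π _ _

/-- The canonical morphism from `A` to the sections. -/
def toSections (x : L) : A ⟶ (quotSheaf H).obj (op x) :=
  sectionsLift H (fun k _ => (H k).proj) (fun _ _ _ _ _ => proj_valueMap H _)

@[simp]
theorem toSections_π {x : L} {k : ScottOpenFilter L} (hx : x ∈ k.carrier) :
    toSections H x ≫ sectionsπ H hx = (H k).proj :=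
  sectionsLift_π _ _ _ _

@[simp]
theorem toSections_π_assoc {x : L} {k : ScottOpenFilter L} (hx : x ∈ k.carrier)
    {Z : C} (γ : _ ⟶ Z) :
    toSections H x ≫ sectionsπ H hx ≫ γ =
      (H k).proj ≫ γ := by
  simp only [← Category.assoc, toSections_π]

@[simp]
theorem toSections_res {x y : L} (h : x ≤ y) :
    toSections H y ≫ res (quotSheaf H) h = toSections H x :=
  sections_hom_ext fun k hk => by simp

/-- The canonical morphism from the quotient at a Scott-open filter to the sections over a lower
bound of that filter. -/
def quotToSections {l : ScottOpenFilter L} {x : L} (h : ∀ z ∈ l.carrier, x ≤ z) :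
    (H l).quot ⟶ (quotSheaf H).obj (op x) :=
  sectionsLift H (fun _ hk => valueMap H (le_def.2 fun z hz => mem_of_le (h z hz) hk))
    (fun _ _ _ _ _ => valueMap_comp H _ _)

@[simp]
theorem quotToSections_π {l : ScottOpenFilter L} {x : L} (h : ∀ z ∈ l.carrier, x ≤ z)
    {k : ScottOpenFilter L} (hx : x ∈ k.carrier) :
    quotToSections H h ≫ sectionsπ H hx =
      valueMap H (le_def.2 fun z hz => mem_of_le (h z hz) hx) :=
  sectionsLift_π _ _ _ _

@[simp]
theorem proj_quotToSections {l : ScottOpenFilter L} {x : L} (h : ∀ z ∈ l.carrier, x ≤ z) :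
    (H l).proj ≫ quotToSections H h = toSections H x :=
  sections_hom_ext fun k hk => by simp

@[simp]
theorem proj_quotToSections_assoc {l : ScottOpenFilter L} {x : L} (h : ∀ z ∈ l.carrier, x ≤ z)
    {Z : C} (γ : _ ⟶ Z) :
    (H l).proj ≫ quotToSections H h ≫ γ =
      toSections H x ≫ γ := by
  simp only [← Category.assoc, proj_quotToSections]

@[simp]
theorem sectionsπ_quotToSections {l : ScottOpenFilter L} {x y : L} (hx : x ∈ l.carrier)
    (h : ∀ z ∈ l.carrier, y ≤ z) :
    sectionsπ H hx ≫ quotToSections H h = res (quotSheaf H) (h x hx) :=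
  sections_hom_ext fun k hk => by simp

@[simp]
theorem sectionsπ_quotToSections_assoc {l : ScottOpenFilter L} {x y : L} (hx : x ∈ l.carrier)
    (h : ∀ z ∈ l.carrier, y ≤ z)
    {Z : C} (γ : _ ⟶ Z) :
    sectionsπ H hx ≫ quotToSections H h ≫ γ =
      res (quotSheaf H) (h x hx) ≫ γ := by
  simp only [← Category.assoc, sectionsπ_quotToSections]

/-- A Scott-open filter containing `sSup D` meets `D`, so each component over `sSup D` is already
visible over some `d ∈ D`; directedness makes the choice of `d` immaterial. No property of `H`
beyond monotonicity is involved. -/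
theorem isLimit_supCone_quotSheaf {D : Set L} (hD : D.Nonempty) (hdir : DirectedOn (· ≤ ·) D) :
    Nonempty (IsLimit (supCone (quotSheaf H) D)) := by
  have hex : ∀ k : ScottOpenFilter L, sSup D ∈ k.carrier → ∃ d ∈ D, d ∈ k.carrier :=
    fun k hk => exists_mem_of_sSup_mem hD hdir hk
  choose δ hδD hδk using hex
  let t (s : Cone (restrict (quotSheaf H) D)) (d : L) (hd : d ∈ D) :
      s.pt ⟶ (quotSheaf H).obj (op d) := s.π.app (op ⟨d, hd⟩)
  have ht : ∀ s d e hd he (h : d ≤ e), t s e he ≫ res (quotSheaf H) h = t s d hd :=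
    fun s d e hd he h => s.w (homOfLE h : (⟨d, hd⟩ : D) ⟶ ⟨e, he⟩).op
  have indep : ∀ s d e hd he (k : ScottOpenFilter L) (hdk : d ∈ k.carrier) (hek : e ∈ k.carrier),
      t s d hd ≫ sectionsπ H hdk = t s e he ≫ sectionsπ H hek := by
    intro s d e hd he k hdk hek
    obtain ⟨f, hf, hdf, hef⟩ := hdir d hd e he
    rw [← ht s d f hd hf hdf, ← ht s e f he hf hef]
    simp
  let lift (s : Cone (restrict (quotSheaf H) D)) : s.pt ⟶ (quotSheaf H).obj (op (sSup D)) :=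
    sectionsLift H (fun k hk => t s (δ k hk) (hδD k hk) ≫ sectionsπ H (hδk k hk))
      (fun k l hk hl h => by
        rw [Category.assoc, sectionsπ_valueMap H _ h]
        exact indep _ _ _ _ _ _ _ _)
  refine ⟨{ lift := lift, fac := fun s d => ?_, uniq := fun s m hm => ?_ }⟩
  · refine sections_hom_ext fun k (hk : d.unop.1 ∈ k.carrier) => ?_
    have h : lift s ≫ res (quotSheaf H) (le_sSup d.unop.2) ≫ sectionsπ H hk =
        t s d.unop.1 d.unop.2 ≫ sectionsπ H hk := by
      rw [res_sectionsπ, sectionsLift_π]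
      exact indep _ _ _ _ _ _ _ _
    exact (Category.assoc _ _ _).trans h
  · refine sections_hom_ext fun k hk => ?_
    let m' : s.pt ⟶ (quotSheaf H).obj (op (sSup D)) := m
    have h : m' ≫ res (quotSheaf H) (le_sSup (hδD k hk)) = t s (δ k hk) (hδD k hk) :=
      hm (op ⟨δ k hk, hδD k hk⟩)
    change m' ≫ _ = _
    rw [sectionsLift_π, ← h, Category.assoc, res_sectionsπ]

end Sections

/-! ### From commuting maps to soft representations. -/

namespace CommutingMap

variable {C : Type u} [Category.{v} C] [BarrExact C] {L : Type v}
  [CompleteLattice L] {A : C} (H : CommutingMap L A)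

theorem le_all (E : EquivRel A) : E ≤ H.1 (all L) :=
  (H.2.1 ∅ (all L) Set.finite_empty ⟨by simp, fun k _ => ScottOpenFilter.le_all k⟩).2 (by simp)

theorem isGLB_inter (k l : ScottOpenFilter L) : IsGLB {H.1 k, H.1 l} (H.1 (inter k l)) := by
  simpa [Set.image_pair] using H.2.1 {k, l} _ (by simp) (ScottOpenFilter.isGLB_inter k l)

theorem quot_hom_ext {k l : ScottOpenFilter L} {T : C} {f g : T ⟶ (H.1 (inter k l)).quot}
    (h₁ : f ≫ valueMap H.1 (inter_le_left k l) =
      g ≫ valueMap H.1 (inter_le_left k l))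
    (h₂ : f ≫ valueMap H.1 (inter_le_right k l) =
      g ≫ valueMap H.1 (inter_le_right k l)) : f = g :=
  EquivRel.quot_hom_ext (H.isGLB_inter k l) _ _ h₁ h₂

theorem onlyTop_le [IsStablyContinuousLattice L] (E : EquivRel A) : H.1 (onlyTop L) ≤ E :=
  (H.2.2.1 ∅ (onlyTop L) ⟨by simp, fun k _ => ScottOpenFilter.onlyTop_le k⟩).2 (by simp)

theorem isLUB_join [IsStablyContinuousLattice L] (k l : ScottOpenFilter L) :
    IsLUB {H.1 k, H.1 l} (H.1 (join k l)) := by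
  simpa [Set.image_pair] using H.2.2.1 {k, l} _ (ScottOpenFilter.isLUB_join k l)

theorem le_of_forall [IsContinuousLattice L] {k : ScottOpenFilter L} {E : EquivRel A}
    (h : ∀ (l : ScottOpenFilter L) (x : L), x ∈ k.carrier → (∀ z ∈ l.carrier, x ≤ z) →
      H.1 l ≤ E) : H.1 k ≤ E :=
  (H.2.2.1 _ _ (isLUB_of_lowerBound_mem k)).2 <| by
    rintro _ ⟨l, ⟨x, hx, hl⟩, rfl⟩
    exact h l x hx hl

variable [HasLimits C]

section

variable [HasColimits C]

theorem toSections_germ {k : ScottOpenFilter L} {x : L} (hx : x ∈ k.carrier) :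
    toSections H.1 x ≫ germ (quotSheaf H.1) hx =
      toSections H.1 ⊤ ≫ germ (quotSheaf H.1) k.top_mem := by
  rw [← toSections_res H.1 (le_top : x ≤ ⊤), Category.assoc, res_germ]

/-- The canonical morphism from the stalk to the quotient at a Scott-open filter. -/
def stalkToQuot (k : ScottOpenFilter L) : stalk (quotSheaf H.1) k ⟶ (H.1 k).quot :=
  stalkDesc _ k (fun _ hx => sectionsπ H.1 hx) (fun _ _ _ _ h => res_sectionsπ H.1 h _)

@[simp]
theorem germ_stalkToQuot {k : ScottOpenFilter L} {x : L} (hx : x ∈ k.carrier) :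
    germ (quotSheaf H.1) hx ≫ H.stalkToQuot k = sectionsπ H.1 hx := germ_stalkDesc _ _ _ _

@[simp]
theorem germ_stalkToQuot_assoc {k : ScottOpenFilter L} {x : L} (hx : x ∈ k.carrier)
    {Z : C} (γ : _ ⟶ Z) :
    germ (quotSheaf H.1) hx ≫ H.stalkToQuot k ≫ γ =
      sectionsπ H.1 hx ≫ γ := by
  simp only [← Category.assoc, germ_stalkToQuot]

variable [IsContinuousLattice L]

/-- As `H` preserves suprema, only filters `l` with a lower bound `x` in `k` matter. For these the
map from `A` to the sections over `x` factors through the quotient by `H l`. -/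
theorem le_ker_toSections_germ (k : ScottOpenFilter L) :
    H.1 k ≤ ker (toSections H.1 ⊤ ≫ germ (quotSheaf H.1) k.top_mem) :=
  H.le_of_forall fun l x hx hl => EquivRel.le_iff.2 fun T a b hab => by
    rw [ker_rel_iff, ← H.toSections_germ hx, ← proj_quotToSections H.1 hl]
    simp only [Category.assoc]
    rw [reassoc_of% comp_proj_eq_iff.2 hab]

/-- The canonical morphism from the quotient at a Scott-open filter to the stalk. -/
def quotToStalk (k : ScottOpenFilter L) : (H.1 k).quot ⟶ stalk (quotSheaf H.1) k :=
  EquivRel.desc _ (H.le_ker_toSections_germ k)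

@[simp]
theorem proj_quotToStalk (k : ScottOpenFilter L) : (H.1 k).proj ≫ H.quotToStalk k =
    toSections H.1 ⊤ ≫ germ (quotSheaf H.1) k.top_mem :=
  proj_desc _ _

/-- This composite makes `quotToStalk` a split epimorphism, so the stalk is covered by `A`, which
gives softness. -/
theorem stalkToQuot_quotToStalk (k : ScottOpenFilter L) :
    H.stalkToQuot k ≫ H.quotToStalk k = 𝟙 _ :=
  stalk_hom_ext fun x hx => by
    obtain ⟨y, hy, -, l, hxl, hl, hlk⟩ := exists_between hx
    have h : quotToSections H.1 hl ≫ germ (quotSheaf H.1) hy =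
        valueMap H.1 hlk ≫ H.quotToStalk k := by
      rw [← cancel_epi (H.1 l).proj, proj_quotToSections_assoc, proj_valueMap_assoc,
        proj_quotToStalk, H.toSections_germ]
    rw [germ_stalkToQuot_assoc, ← sectionsπ_valueMap H.1 hxl hlk, Category.assoc, ← h,
      sectionsπ_quotToSections_assoc, res_germ, Category.comp_id]

theorem isSoft_quotSheaf : IsSoft (quotSheaf H.1) := fun k => by
  have : IsSplitEpi (H.quotToStalk k) := ⟨⟨⟨_, H.stalkToQuot_quotToStalk k⟩⟩⟩
  have : StrongEpi (toSections H.1 ⊤ ≫ germ (quotSheaf H.1) k.top_mem) := by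
    rw [← proj_quotToStalk]
    exact strongEpi_comp _ _
  have : StrongEpi (germ (quotSheaf H.1) k.top_mem) := strongEpi_of_strongEpi (toSections H.1 ⊤) _
  change IsRegularEpi (germ (quotSheaf H.1) k.top_mem)
  infer_instance

end

variable [IsStablyContinuousLattice L]

theorem sup_hom_ext {x y : L} {T : C} {f g : T ⟶ (quotSheaf H.1).obj (op (x ⊔ y))}
    (h₁ : f ≫ res (quotSheaf H.1) le_sup_left = g ≫ res (quotSheaf H.1) le_sup_left)
    (h₂ : f ≫ res (quotSheaf H.1) le_sup_right = g ≫ res (quotSheaf H.1) le_sup_right) :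
    f = g := by
  refine sections_hom_ext fun m hm => ?_
  obtain ⟨k, l, hk, hl, hle⟩ := exists_inter_le_of_sup_mem hm
  have hkl : x ⊔ y ∈ (inter k l).carrier := ⟨mem_of_le le_sup_left hk, mem_of_le le_sup_right hl⟩
  have key : f ≫ sectionsπ H.1 hkl = g ≫ sectionsπ H.1 hkl := by
    refine H.quot_hom_ext ?_ ?_
    · simpa using h₁ =≫ sectionsπ H.1 hk
    · simpa using h₂ =≫ sectionsπ H.1 hl
  simpa using key =≫ valueMap H.1 hle

theorem exists_sup_lift {x y : L} {T : C} {f : T ⟶ (quotSheaf H.1).obj (op x)}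
    {g : T ⟶ (quotSheaf H.1).obj (op y)}
    (h : f ≫ res (quotSheaf H.1) (inf_le_left : x ⊓ y ≤ x) =
      g ≫ res (quotSheaf H.1) (inf_le_right : x ⊓ y ≤ y)) :
    ∃ t : T ⟶ (quotSheaf H.1).obj (op (x ⊔ y)),
      t ≫ res (quotSheaf H.1) le_sup_left = f ∧ t ≫ res (quotSheaf H.1) le_sup_right = g := by
  -- The Chinese remainder theorem glues the components of `f` at `k` and of `g` at `l` over the
  -- intersection. Any filter containing `x ⊔ y` includes such an intersection, and `indep` shows
  -- that the component obtained there does not depend on it.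
  have hu : ∀ (k l : ScottOpenFilter L) (hk : x ∈ k.carrier) (hl : y ∈ l.carrier),
      ∃ u : T ⟶ (H.1 (inter k l)).quot,
        u ≫ valueMap H.1 (inter_le_left k l) = f ≫ sectionsπ H.1 hk ∧
        u ≫ valueMap H.1 (inter_le_right k l) = g ≫ sectionsπ H.1 hl := by
    intro k l hk hl
    refine exists_quot_lift (H.2.2.2 k l) (H.isGLB_inter k l) (H.isLUB_join k l) _ _
      (H.1.monotone (le_join_left k l)) (H.1.monotone (le_join_right k l)) ?_
    change (f ≫ _) ≫ valueMap H.1 (le_join_left k l) = (g ≫ _) ≫ valueMap H.1 (le_join_right k l)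
    simpa using h =≫ sectionsπ H.1 (inf_mem_join hk hl)
  choose u hu₁ hu₂ using hu
  have hmono : ∀ k k' l l' hk hk' hl hl' (hkk : k ≤ k') (hll : l ≤ l'),
      u k l hk hl ≫ valueMap H.1 (le_inter ((inter_le_left k l).trans hkk)
        ((inter_le_right k l).trans hll)) = u k' l' hk' hl' := by
    intro k k' l l' hk hk' hl hl' hkk hll
    refine H.quot_hom_ext ?_ ?_
    · have := hu₁ k l hk hl =≫ valueMap H.1 hkk
      rw [Category.assoc, valueMap_comp, hu₁, ← sectionsπ_valueMap H.1 hk hkk]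
      simpa using this
    · have := hu₂ k l hk hl =≫ valueMap H.1 hll
      rw [Category.assoc, valueMap_comp, hu₂, ← sectionsπ_valueMap H.1 hl hll]
      simpa using this
  have indep : ∀ k k' l l' hk hk' hl hl' m (hm : inter k l ≤ m) (hm' : inter k' l' ≤ m),
      u k l hk hl ≫ valueMap H.1 hm = u k' l' hk' hl' ≫ valueMap H.1 hm' := by
    intro k k' l l' hk hk' hl hl' m hm hm'
    rw [← hmono (inter k k') k (inter l l') l ⟨hk, hk'⟩ hk ⟨hl, hl'⟩ hl
        (inter_le_left _ _) (inter_le_left _ _),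
      ← hmono (inter k k') k' (inter l l') l' ⟨hk, hk'⟩ hk' ⟨hl, hl'⟩ hl'
        (inter_le_right _ _) (inter_le_right _ _)]
    simp
  choose κ μ hκ hμ hκμ using fun (m : ScottOpenFilter L) (hm : x ⊔ y ∈ m.carrier) =>
    exists_inter_le_of_sup_mem hm
  let t : T ⟶ (quotSheaf H.1).obj (op (x ⊔ y)) := sectionsLift H.1
    (fun m hm => u (κ m hm) (μ m hm) (hκ m hm) (hμ m hm) ≫ valueMap H.1 (hκμ m hm))
    (fun m m' hm hm' hle => by
      rw [Category.assoc, valueMap_comp]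
      exact indep _ _ _ _ _ _ _ _ _ ((hκμ m hm).trans hle) (hκμ m' hm'))
  refine ⟨t, sections_hom_ext fun m hm => ?_, sections_hom_ext fun m hm => ?_⟩
  · have hm' := mem_of_le (le_sup_left : x ≤ x ⊔ y) hm
    rw [Category.assoc, res_sectionsπ, sectionsLift_π,
      indep _ m _ (μ m hm') _ hm _ (hμ m hm') m (hκμ m hm') (inter_le_left _ _), hu₁]
  · have hm' := mem_of_le (le_sup_right : y ≤ x ⊔ y) hm
    rw [Category.assoc, res_sectionsπ, sectionsLift_π,
      indep _ (κ m hm') _ m _ (hκ m hm') _ hm m (hκμ m hm') (inter_le_right _ _), hu₂]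

theorem isOmegaSheaf_quotSheaf : IsOmegaSheaf (quotSheaf H.1) where
  subterminal T f g := sections_hom_ext fun k hk => by
    obtain rfl := eq_all_of_bot_mem hk
    exact isSubterminal_quot H.le_all _ _
  isPullback x y := by
    refine ⟨⟨(res_res _ _ _).trans (res_res _ _ _).symm⟩, ⟨PullbackCone.IsLimit.mk _
      (fun s => (H.exists_sup_lift s.condition).choose)
      (fun s => (H.exists_sup_lift s.condition).choose_spec.1)
      (fun s => (H.exists_sup_lift s.condition).choose_spec.2)
      (fun s m h₁ h₂ => H.sup_hom_ext ?_ ?_)⟩⟩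
    · exact h₁.trans (H.exists_sup_lift s.condition).choose_spec.1.symm
    · exact h₂.trans (H.exists_sup_lift s.condition).choose_spec.2.symm
  isLimit _ hD hdir := isLimit_supCone_quotSheaf H.1 hD hdir

/-- The least filter `onlyTop L` contains `⊤`, so the limit over all filters is the quotient there;
this is `A`, since `H` sends the least filter to the least equivalence relation. -/
theorem isIso_toSections_top : IsIso (toSections H.1 ⊤) := by
  have := isIso_proj H.onlyTop_le
  refine ⟨sectionsπ H.1 (onlyTop L).top_mem ≫ inv (H.1 (onlyTop L)).proj, by simp, ?_⟩
  refine sections_hom_ext fun k hk => ?_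
  rw [Category.assoc, Category.assoc, toSections_π, Category.id_comp,
    ← sectionsπ_valueMap H.1 (onlyTop L).top_mem (ScottOpenFilter.onlyTop_le k),
    ← proj_valueMap H.1 (ScottOpenFilter.onlyTop_le k), IsIso.inv_hom_id_assoc]

/-- The representation associated with a commuting map. -/
def rep : OmegaSheafRep L A where
  sheaf := quotSheaf H.1
  isOmegaSheaf := H.isOmegaSheaf_quotSheaf
  iso := have := H.isIso_toSections_top; asIso (toSections H.1 ⊤)

theorem stalkKer_rep [HasColimits C] (k : ScottOpenFilter L) : H.rep.stalkKer k = H.1 k := by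
  apply le_antisymm
  · refine EquivRel.le_iff.2 fun T a b hab => comp_proj_eq_iff.1 ?_
    have h : (toSections H.1 ⊤ ≫ germ (quotSheaf H.1) k.top_mem) ≫ H.stalkToQuot k =
      (H.1 k).proj := by simp
    rw [← h]
    exact (Category.assoc _ _ _).symm.trans
      ((OmegaSheafRep.stalkKer_rel_iff.1 hab =≫ H.stalkToQuot k).trans (Category.assoc _ _ _))
  · exact H.le_ker_toSections_germ k

end CommutingMap

end SoftSheaf
end
-- The order isomorphism.
theorem mainTheorem5 {C : Type u} [Category.{v} C] [HasLimits C] [HasColimits C]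
    [SoftSheaf.BarrExact C] (hC : SoftSheaf.DirectedColimitsCommuteWithFiniteLimits C)
    (L : Type v) [CompleteLattice L] [SoftSheaf.IsStablyContinuousLattice L] (A : C) :
    Quiver.IsThin (SoftSheaf.SoftOmegaSheafRep L A) ∧
      Nonempty (SoftSheaf.CommutingMap L A ≃o ThinSkeleton (SoftSheaf.SoftOmegaSheafRep L A)) := by
  have hthin : Quiver.IsThin (SoftSheaf.SoftOmegaSheafRep L A) := fun F G =>
    ⟨fun α β => ObjectProperty.hom_ext _
      ((SoftSheaf.OmegaSheafRep.hom_subsingleton F.property).elim _ _)⟩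
  refine ⟨hthin, ?_⟩
  let E : SoftSheaf.SoftOmegaSheafRep L A → SoftSheaf.CommutingMap L A := fun F =>
    SoftSheaf.OmegaSheafRep.commutingMap F.property hC
  have hE : ∀ F G, E F ≤ E G ↔ Nonempty (F ⟶ G) := fun F G =>
    ⟨fun h => (SoftSheaf.OmegaSheafRep.exists_hom F.property h).map ObjectProperty.homMk,
      fun ⟨α⟩ => SoftSheaf.OmegaSheafRep.stalkKer_le_of_hom α.hom⟩
  let S : SoftSheaf.CommutingMap L A → SoftSheaf.SoftOmegaSheafRep L A := fun H =>
    ⟨H.rep, H.isSoft_quotSheaf⟩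
  have hES : ∀ H, E (S H) = H := fun H => Subtype.ext (OrderHom.ext _ _ (funext H.stalkKer_rep))
  -- No comparison of sheaves is needed: `S (E F)` and `F` have the same image under `E`, so
  -- morphisms exist both ways, and thinness makes them inverse.
  have hSE : ∀ F, Nonempty (S (E F) ≅ F) := fun F => by
    obtain ⟨α⟩ := (hE (S (E F)) F).1 (hES (E F)).le
    obtain ⟨β⟩ := (hE F (S (E F))).1 (hES (E F)).ge
    exact ⟨⟨α, β, Subsingleton.elim _ _, Subsingleton.elim _ _⟩⟩
  let f : SoftSheaf.CommutingMap L A → ThinSkeleton (SoftSheaf.SoftOmegaSheafRep L A) :=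
    fun H => (ThinSkeleton.mk (S H))
  have hf : Function.Bijective f := by
    refine ⟨fun H K h => ?_, fun F => ?_⟩
    · obtain ⟨i⟩ := Quotient.exact h
      rw [← hES H, ← hES K]
      exact le_antisymm ((hE _ _).2 ⟨i.hom⟩) ((hE _ _).2 ⟨i.inv⟩)
    · induction F using Quotient.inductionOn with
      | h F => exact ⟨E F, Quotient.sound (hSE F)⟩
  refine ⟨⟨Equiv.ofBijective f hf, fun {H K} => ?_⟩⟩
  have h := hE (S H) (S K)
  rw [hES, hES] at h
  exact h.symm
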